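/- Let $\mathcal X\subset\mathbb R^d$ be compact. Let $\{\zeta_i\}_{i\ge1}$ be the points of a Poisson process on $(0,\infty)$ with intensity $\zeta^{-2}\,d\zeta$. Let $Y_1,Y_2,\dots$ be i.i.d. copies, independent of $(\zeta_i)$, of a nonnegative process $Y$ on $\mathcal X$ with continuous sample paths, $\mathbb E\,Y(s)=1$ for all $s\in\mathcal X$, and $\mathbb E\sup_{s\in\mathcal X}Y(s)<\infty$. Let $\eta(s)=\max_{i\ge1}\zeta_iY_i(s)$, $s\in\mathcal X$, and for $k\ge1$ and $s_1,\dots,s_k\in\mathcal X$ let $$p(s_1,\dots,s_k)=\mathbb P\{\text{for some }\ell\ge1:\ \eta(s_j)=\zeta_\ell Y_\ell(s_j),\ j=1,\dots,k\}$$ be the extremal concurrence probability. Let $\tilde\eta_1,\tilde\eta_2,\dots$ be independent copies of the process $\eta$ (same law as $\eta$ as processes on $\mathcal X$), independent of $(\zeta_i)_{i\ge1}$ and $(Y_i)_{i\ge1}$, and let $$\xi(s)=\max_{i\ge1}\zeta_i\,\frac{Y_i(s)}{\tilde\eta_i(s)},\qquad s\in\mathcal X.$$ Then $\xi$ is a simple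 max-stable process, that is, $\mathbb P\{\xi(s)\le x\}=e^{-1/x}$ for all $s\in\mathcal X$ and $x>0$, and for every $n\ge1$ the process $n^{-1}\max(\xi_1,\dots,\xi_n)$, with $\xi_1,\dots,\xi_n$ independent copies of $\xi$, has the same finite-dimensional distributions as $\xi$. Moreover, for all $s_1,\dots,s_k\in\mathcal X$, $k\ge1$, one has $\mathbb P\{\xi(s_j)\le1,\ j=1,\dots,k\}>0$ and $$p(s_1,\dots,s_k)=\sum_{r=1}^k(-1)^{r+1}\sum_{J\subseteq\{1,\dots,k\},\ |J|=r}\theta_\xi(s_j,\ j\in J),\qquad \theta_\xi(s_j,\ j\in J)=-\log\mathbb P\{\xi(s_j)\le1,\ j\in J\}.$$ In particular $p(s_1,s_2)=2-\theta_\xi(s_1,s_2)$ for all $s_1,s_2\in\mathcal X$. -/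

import Mathlib

open MeasureTheory ProbabilityTheory Set
open scoped ENNReal NNReal

noncomputable section

namespace ConcurrenceOfExtremes

/-- `N` is a Poisson random measure (Poisson point process) with σ-finite intensity `μ`: counts of
sets of finite intensity are Poisson distributed with mean `μ A`, and counts of pairwise disjoint
sets are independent. -/
structure IsPoissonProcess {Ω E : Type*} [MeasurableSpace Ω] [MeasurableSpace E]
    (P : Measure Ω) (N : Ω → Measure E) (μ : Measure E) : Prop where
  measurable_count : ∀ A : Set E, MeasurableSet A → Measurable (fun ω => N ω A)
  law_count : ∀ A : Set E, MeasurableSet A → μ A ≠ ∞ →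
    P.map (fun ω => N ω A) =
      (poissonMeasure (μ A).toNNReal).map (fun n : ℕ => (n : ℝ≥0∞))
  indep_count : ∀ (n : ℕ) (A : Fin n → Set E), (∀ i, MeasurableSet (A i)) →
    Pairwise (fun i j => Disjoint (A i) (A j)) → iIndepFun (fun i ω => N ω (A i)) P

/-- The measure `ζ⁻² dζ` on `(0, ∞)`, seen as a measure on `ℝ`. -/
def frechetIntensity : Measure ℝ :=
  (volume.restrict (Ioi (0 : ℝ))).withDensity (fun x => ENNReal.ofReal ((x ^ 2)⁻¹))

/-- The random reals `ζ 0, ζ 1, …` are, in some measurable enumeration, the points of a Poisson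
process on `(0, ∞)` with intensity `ζ⁻² dζ` (in particular they are almost surely positive). -/
structure IsFrechetPoints {Ω : Type*} [MeasurableSpace Ω]
    (P : Measure Ω) (ζ : ℕ → Ω → ℝ) : Prop where
  measurable : ∀ i, Measurable (ζ i)
  poisson : IsPoissonProcess P (fun ω => Measure.sum (fun i => Measure.dirac (ζ i ω)))
    frechetIntensity

/-- A nonnegative process with continuous sample paths, `E Y(t) = 1` for every `t`, and
`E sup_t Y(t) < ∞`. -/
structure IsSpectralProcess {Ω T : Type*} [MeasurableSpace Ω] [TopologicalSpace T]
    (P : Measure Ω) (Y : Ω → T → ℝ) : Prop where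
  measurable : Measurable Y
  nonneg : ∀ ω t, 0 ≤ Y ω t
  continuous_path : ∀ ω, Continuous (Y ω)
  mean_eq_one : ∀ t, ∫ ω, Y ω t ∂P = 1
  sup_integrable : ∫⁻ ω, ⨆ t, ENNReal.ofReal (Y ω t) ∂P < ∞

/-- The data of a spectral representation: the points `ζ i` of a Poisson process on `(0, ∞)` with
intensity `ζ⁻² dζ`, and i.i.d. spectral processes `Y i`, independent of the points. -/
structure IsSpectralRepresentation {Ω T : Type*} [MeasurableSpace Ω] [TopologicalSpace T]
    (P : Measure Ω) (ζ : ℕ → Ω → ℝ) (Y : ℕ → Ω → T → ℝ) : Prop where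
  points : IsFrechetPoints P ζ
  spectral : ∀ i, IsSpectralProcess P (Y i)
  identDistrib : ∀ i, IdentDistrib (Y i) (Y 0) P P
  indep : iIndepFun Y P
  indep_points : IndepFun (fun ω i => ζ i ω) (fun ω i => Y i ω) P

/-- The process `t ↦ max_i ζ_i Z_i(t)`. -/
def maxProcess {Ω T : Type*} (ζ : ℕ → Ω → ℝ) (Z : ℕ → Ω → T → ℝ) (ω : Ω) (t : T) : ℝ :=
  ⨆ i, ζ i ω * Z i ω t

/-- The extremal concurrence probability: the probability that a single function
`φ_ℓ = ζ_ℓ Y_ℓ` attains the maximum `max_i ζ_i Y_i` at all the sites `s j`. -/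
def concurrenceProb {Ω T ι : Type*} [MeasurableSpace Ω] (P : Measure Ω)
    (ζ : ℕ → Ω → ℝ) (Y : ℕ → Ω → T → ℝ) (s : ι → T) : ℝ :=
  P.real {ω | ∃ l, ∀ j, maxProcess ζ Y ω (s j) = ζ l ω * Y l ω (s j)}

/-- The extremal coefficient `-log P (ξ(s_j) ≤ 1 for all j)` of `ξ` at the sites `s j`. -/
def extremalCoefficient {Ω T ι : Type*} [MeasurableSpace Ω] (P : Measure Ω)
    (ξ : Ω → T → ℝ) (s : ι → T) : ℝ :=
  -Real.log (P.real {ω | ∀ j, ξ ω (s j) ≤ 1})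

/-- A simple max-stable process: unit Fréchet margins, and for every `n ≥ 1` the rescaled pointwise
maximum `n⁻¹ max (ξ_1, …, ξ_n)` of `n` independent copies (built on the product space) has the same
law as `ξ`, as a random element of the product `σ`-algebra on functions. -/
structure IsSimpleMaxStable {Ω T : Type*} [MeasurableSpace Ω]
    (P : Measure Ω) (ξ : Ω → T → ℝ) : Prop where
  margins : ∀ t, ∀ x : ℝ, 0 < x → P.real {ω | ξ ω t ≤ x} = Real.exp (-x⁻¹)
  maxStable : ∀ n : ℕ, 1 ≤ n →
    IdentDistrib (fun (ω : Fin n → Ω) t => (⨆ i, ξ (ω i) t) / (n : ℝ)) ξ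
      (Measure.pi (fun _ => P)) P

/-- `η' i` are independent copies of the process `η = max_i ζ_i Y_i`, independent of the
points `ζ i` and the spectral processes `Y i`. -/
structure AreIndependentCopies {Ω T : Type*} [MeasurableSpace Ω]
    (P : Measure Ω) (ζ : ℕ → Ω → ℝ) (Y : ℕ → Ω → T → ℝ) (η' : ℕ → Ω → T → ℝ) : Prop where
  measurable : ∀ i, Measurable (η' i)
  identDistrib : ∀ i, IdentDistrib (η' i) (maxProcess ζ Y) P P
  indep : iIndepFun η' P
  indep_data : IndepFun (fun ω => ((fun i => ζ i ω), (fun i => Y i ω))) (fun ω i => η' i ω) P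

end ConcurrenceOfExtremes

end

open ConcurrenceOfExtremes

noncomputable section

namespace ConcurrenceOfExtremes

section

/-! ### The intensity `ζ⁻² dζ` -/

/-! By the marking theorem, the points `(ζ i, W i)` have the generating functional of a Poisson
process with intensity `ζ⁻² dζ ⊗ ν`, both for `W = Y` and for `W = Y / η'`. Whenever `ν` has
nonnegative coordinates of mean one, the void probabilities give `-log P(max_i ζ_i W_i(s_j) ≤ x_j
for all j) = E max_j W(s_j) / x_j`. This exponent is homogeneous of degree `-1`, so the maximum is
simple max-stable and its extremal coefficient is `E max_j W(s_j)`. The ratio `Y / η'` qualifies: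
numerator and denominator are independent, `E Y(t) = 1`, and `1 / η(t)` is standard exponential,
hence of mean one.

For the concurrence probability, a Mecke formula (`IsMarkedPoisson.lintegral_count`,
`IsMarkedPoisson.sum_map_eq`) shows that a Poisson point sees the maximum of the other points as an
independent copy of `η`. Integrating out `ζ`, the expected number of indices attaining the maximum
at all sites is `E min_j Y(s_j) / η'(s_j)`. At a single site this number is 1; as some index attains
the maximum almost surely, that index is almost surely unique
(`IsMarkedPoisson.ae_existsUnique_attained`), and the expected number is a probability. So `p = E
min_j (Y / η')(s_j)` while `θ_ξ = E max_j (Y / η')(s_j)`, and the maximum-minimums identity links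
the two. -/

instance sigmaFinite_frechetIntensity : SigmaFinite frechetIntensity :=
  SigmaFinite.withDensity_ofReal _

instance nullSingletonClass_frechetIntensity : NullSingletonClass frechetIntensity := by
  refine ⟨fun x => ?_⟩
  exact (withDensity_absolutelyContinuous _ _) (measure_singleton x)

lemma frechetIntensity_Ioi {c : ℝ} (hc : 0 < c) :
    frechetIntensity (Ioi c) = ENNReal.ofReal c⁻¹ := by
  have h2 : ∀ x ∈ Ioi c, x ^ (-2 : ℝ) = (x ^ 2)⁻¹ := fun x hx => by
    have hx0 : 0 < x := hc.trans hx
    rw [Real.rpow_neg hx0.le]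
    norm_cast
  have hint : IntegrableOn (fun x : ℝ => (x ^ 2)⁻¹) (Ioi c) :=
    (integrableOn_Ioi_rpow_of_lt (by norm_num : (-2 : ℝ) < -1) hc).congr_fun h2 measurableSet_Ioi
  rw [frechetIntensity, withDensity_apply _ measurableSet_Ioi,
    Measure.restrict_restrict measurableSet_Ioi,
    inter_eq_left.2 (Ioi_subset_Ioi hc.le),
    ← ofReal_integral_eq_lintegral_ofReal hint (ae_of_all _ fun x => by positivity),
    ← setIntegral_congr_fun measurableSet_Ioi h2,
    integral_Ioi_rpow_of_lt (by norm_num : (-2 : ℝ) < -1) hc]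
  congr 1
  norm_num
  rw [Real.rpow_neg_one]

/-- Integrating out `ζ` turns the event `1 < ζ m` into the number `m`. With `m` a maximum over sites
this yields the exponent; the non-strict version, with `m` a minimum, yields the concurrence
probability. -/
lemma frechetIntensity_one_lt_mul {m : ℝ} (hm : 0 ≤ m) :
    frechetIntensity {z | 1 < z * m} = ENNReal.ofReal m := by
  rcases hm.eq_or_lt with rfl | hm
  · simp [not_lt.2 zero_le_one]
  · have : {z : ℝ | 1 < z * m} = Ioi m⁻¹ := by
      ext z
      rw [mem_ofPred_eq, mem_Ioi, inv_lt_iff_one_lt_mul₀ hm]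
    rw [this, frechetIntensity_Ioi (inv_pos.2 hm), inv_inv]

lemma frechetIntensity_one_le_mul {m : ℝ} (hm : 0 ≤ m) :
    frechetIntensity {z | 1 ≤ z * m} = ENNReal.ofReal m := by
  rcases hm.eq_or_lt with rfl | hm
  · simp [not_le.2 zero_lt_one]
  · have : {z : ℝ | 1 ≤ z * m} = Ici m⁻¹ := by
      ext z
      rw [mem_ofPred_eq, mem_Ici, inv_le_iff_one_le_mul₀ hm]
    rw [this, ← measure_congr (Ioi_ae_eq_Ici (μ := frechetIntensity)),
      frechetIntensity_Ioi (inv_pos.2 hm), inv_inv]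

/-! ### Infinite products of factors in `[0, 1]` -/

/-- The infinite product of a sequence with values in `[0, 1]`, as the infimum of the partial
products. -/
def infProd (f : ℕ → ℝ≥0∞) : ℝ≥0∞ := ⨅ n, ∏ i ∈ Finset.range n, f i

lemma antitone_prod_range {f : ℕ → ℝ≥0∞} (hf : ∀ i, f i ≤ 1) :
    Antitone fun n => ∏ i ∈ Finset.range n, f i :=
  antitone_nat_of_succ_le fun n => by
    rw [Finset.prod_range_succ]
    exact mul_le_of_le_one_right' (hf n)

lemma infProd_le_one (f : ℕ → ℝ≥0∞) : infProd f ≤ 1 :=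
  (iInf_le _ 0).trans (by simp)

lemma infProd_eq_of_eventually {f : ℕ → ℝ≥0∞} (hf : ∀ i, f i ≤ 1) {m : ℕ}
    (h : ∀ i, m ≤ i → f i = 1) : infProd f = ∏ i ∈ Finset.range m, f i := by
  refine le_antisymm (iInf_le _ m) (le_iInf fun n => ?_)
  rcases le_total n m with hn | hn
  · exact antitone_prod_range hf hn
  · rw [← Finset.prod_range_mul_prod_Ico f hn,
      Finset.prod_eq_one (s := Finset.Ico m n) (fun i hi => h i (Finset.mem_Ico.1 hi).1), mul_one]

/-- Makes void probabilities a special case of the generating functional. -/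
lemma infProd_indicator {p : ℕ → Prop} [DecidablePred p] :
    infProd (fun i => if p i then 1 else 0) = open Classical in if ∀ i, p i then 1 else 0 := by
  classical
  split_ifs with h
  · simp [infProd, h]
  · push Not at h
    obtain ⟨i, hi⟩ := h
    refine le_antisymm ((iInf_le _ (i + 1)).trans ?_) bot_le
    rw [Finset.prod_range_succ]
    simp [hi]

lemma measurable_infProd {α : Type*} [MeasurableSpace α] {f : ℕ → α → ℝ≥0∞}
    (hf : ∀ i, Measurable (f i)) : Measurable fun a => infProd fun i => f i a :=
  Measurable.iInf fun _ => Finset.measurable_prod _ fun i _ => hf i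

lemma lintegral_infProd {α : Type*} [MeasurableSpace α] {P : Measure α} [IsProbabilityMeasure P]
    {f : ℕ → α → ℝ≥0∞} (hf : ∀ i, Measurable (f i)) (hf1 : ∀ i a, f i a ≤ 1) :
    ∫⁻ a, infProd (fun i => f i a) ∂P = ⨅ n, ∫⁻ a, ∏ i ∈ Finset.range n, f i a ∂P := by
  refine lintegral_iInf (fun n => Finset.measurable_prod _ fun i _ => hf i)
    (fun m n h a => antitone_prod_range (fun i => hf1 i a) h) ?_
  simp

/-! ### Poisson processes -/

/-- The Poisson generating function at `1 - c`: the exponential series sums to `e^{-r} e^{r(1-c)}`.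
Real powers appear because counts take values in `ℝ≥0∞`. -/
lemma lintegral_rpow_poisson (r : ℝ≥0) {c : ℝ≥0∞} (hc : c ≤ 1) :
    ∫⁻ x, (1 - c) ^ x.toReal ∂((poissonMeasure r).map (fun n : ℕ => (n : ℝ≥0∞))) =
      ENNReal.ofReal (Real.exp (-(c * r).toReal)) := by
  have hq : 1 - c = ENNReal.ofReal (1 - c.toReal) := by
    rw [ENNReal.ofReal_sub _ ENNReal.toReal_nonneg, ENNReal.ofReal_one,
      ENNReal.ofReal_toReal (ne_top_of_le_ne_top ENNReal.one_ne_top hc)]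
  have hc1 : 0 ≤ 1 - c.toReal := by
    have := ENNReal.toReal_mono ENNReal.one_ne_top hc
    simp at this
    linarith
  have hterm : ∀ n : ℕ, 0 ≤ Real.exp (-r) * (r * (1 - c.toReal)) ^ n / n.factorial := fun n => by
    positivity
  have hsum : HasSum (fun n : ℕ => Real.exp (-r) * (r * (1 - c.toReal)) ^ n / n.factorial)
      (Real.exp (-(c * r).toReal)) := by
    have h := (NormedSpace.expSeries_div_hasSum_exp ((r : ℝ) * (1 - c.toReal))).mul_left
      (Real.exp (-r))
    rw [← Real.exp_eq_exp_ℝ, ← Real.exp_add] at h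
    have hexp : -(c * r).toReal = -(r : ℝ) + r * (1 - c.toReal) := by
      rw [ENNReal.toReal_mul, ENNReal.coe_toReal]
      ring
    rw [hexp]
    exact h.congr_fun fun n => mul_div_assoc _ _ _
  rw [lintegral_map (by fun_prop) .of_discrete]
  simp only [ENNReal.toReal_natCast, ENNReal.rpow_natCast]
  rw [poissonMeasure, lintegral_sum_measure]
  simp only [lintegral_smul_measure, lintegral_dirac, smul_eq_mul]
  rw [← hsum.tsum_eq, ENNReal.ofReal_tsum_of_nonneg hterm hsum.summable]
  congr 1
  ext n
  rw [hq, ← ENNReal.ofReal_pow hc1, ← ENNReal.ofReal_mul (by positivity), mul_pow]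
  congr 1
  ring

lemma sum_dirac_apply (z : ℕ → ℝ) {A : Set ℝ} (hA : MeasurableSet A) :
    Measure.sum (fun i => Measure.dirac (z i)) A = ({i | z i ∈ A}.encard : ℝ≥0∞) := by
  rw [Measure.sum_apply _ hA, ← ENNReal.tsum_set_one, tsum_subtype {i | z i ∈ A} fun _ => (1 : ℝ≥0∞)]
  congr 1
  ext i
  rw [Measure.dirac_apply' _ hA]
  rfl

/-- Only finitely many points lie where `φ ≠ 0`, so the product is finite and its factors can be
grouped by the value of `φ`. -/
lemma infProd_simpleFunc (φ : SimpleFunc ℝ ℝ≥0∞) (z : ℕ → ℝ)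
    (hz : ∀ c ∈ φ.range, c ≠ 0 → Measure.sum (fun i => Measure.dirac (z i)) (φ ⁻¹' {c}) ≠ ∞) :
    infProd (fun i => 1 - φ (z i)) = ∏ c ∈ φ.range,
      (1 - c) ^ (Measure.sum (fun i => Measure.dirac (z i)) (φ ⁻¹' {c})).toReal := by
  classical
  have hfin : ∀ c ∈ φ.range, c ≠ 0 → {i | φ (z i) = c}.Finite := fun c hc hc0 => by
    have := hz c hc hc0
    rw [sum_dirac_apply _ (φ.measurableSet_fiber c)] at this
    simpa [Set.encard_eq_top_iff] using this
  have hS : {i | φ (z i) ≠ 0}.Finite := by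
    refine ((φ.range.filter (· ≠ 0)).finite_toSet.biUnion
      (t := fun c => {i | φ (z i) = c}) fun c hc => ?_).subset fun i hi => ?_
    · simp only [Finset.coe_filter, mem_ofPred_eq] at hc
      exact hfin c hc.1 hc.2
    · simp only [mem_iUnion]
      exact ⟨φ (z i), by simpa using hi, rfl⟩
  obtain ⟨m, hm⟩ := hS.bddAbove
  have h1 : ∀ i, m + 1 ≤ i → φ (z i) = 0 := fun i hi => by
    by_contra h
    have := hm h
    omega
  rw [infProd_eq_of_eventually (fun i => tsub_le_self) (m := m + 1)
      (fun i hi => by rw [h1 i hi, tsub_zero]),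
    ← Finset.prod_fiberwise_of_maps_to (t := φ.range) (g := fun i => φ (z i))
      (fun i _ => φ.mem_range_self _)]
  refine Finset.prod_congr rfl fun c hc => ?_
  rw [Finset.prod_congr rfl (g := fun _ => 1 - c)
    (fun i hi => by rw [(Finset.mem_filter.1 hi).2]), Finset.prod_const]
  by_cases hc0 : c = 0
  -- For `c = 0` the base is 1, so the value of `toReal` at an infinite count is harmless.
  · simp [hc0]
  · have hset : {i | z i ∈ φ ⁻¹' {c}} =
        ((Finset.range (m + 1)).filter fun i => φ (z i) = c : Finset ℕ) := by
      ext i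
      simp only [mem_preimage, mem_singleton_iff, mem_ofPred_eq, Finset.coe_filter,
        Finset.mem_range]
      refine ⟨fun h => ⟨?_, h⟩, fun h => h.2⟩
      by_contra hi
      exact hc0 (h ▸ h1 i (not_lt.1 hi))
    rw [sum_dirac_apply _ (φ.measurableSet_fiber c), hset, Set.encard_coe_eq_coe_finsetCard]
    simp

variable {Ω : Type*} [MeasurableSpace Ω] {P : Measure Ω} {ζ : ℕ → Ω → ℝ}

lemma IsFrechetPoints.ae_count_ne_top (h : IsFrechetPoints P ζ) {A : Set ℝ}
    (hA : MeasurableSet A) (hA' : frechetIntensity A ≠ ∞) :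
    ∀ᵐ ω ∂P, Measure.sum (fun i => Measure.dirac (ζ i ω)) A ≠ ∞ := by
  have hm := h.poisson.measurable_count A hA
  have : ∀ᵐ x ∂(P.map fun ω => Measure.sum (fun i => Measure.dirac (ζ i ω)) A), x ≠ ∞ := by
    rw [h.poisson.law_count A hA hA',
      ae_map_iff Measurable.of_discrete.aemeasurable
        (p := fun x : ℝ≥0∞ => x ≠ ∞) (measurableSet_singleton ∞).compl]
    exact ae_of_all _ fun n => ENNReal.natCast_ne_top n
  exact ae_of_ae_map hm.aemeasurable this

variable [IsProbabilityMeasure P]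

/-- The level sets of `φ` are disjoint, so their counts are independent and the Poisson generating
functions multiply. -/
lemma IsFrechetPoints.lintegral_infProd_simpleFunc (h : IsFrechetPoints P ζ)
    (φ : SimpleFunc ℝ ℝ≥0∞) (hφ : ∀ x, φ x ≤ 1) (hfin : φ.lintegral frechetIntensity ≠ ∞) :
    ∫⁻ ω, infProd (fun i => 1 - φ (ζ i ω)) ∂P =
      ENNReal.ofReal (Real.exp (-(φ.lintegral frechetIntensity).toReal)) := by
  classical
  have hms := SimpleFunc.finMeasSupp_iff.1 (SimpleFunc.FinMeasSupp.of_lintegral_ne_top hfin)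
  have hae : ∀ᵐ ω ∂P, infProd (fun i => 1 - φ (ζ i ω)) = ∏ c : φ.range,
      (1 - (c : ℝ≥0∞)) ^
        (Measure.sum (fun i => Measure.dirac (ζ i ω)) (φ ⁻¹' {(c : ℝ≥0∞)})).toReal := by
    have : ∀ᵐ ω ∂P, ∀ c : φ.range, (c : ℝ≥0∞) ≠ 0 →
        Measure.sum (fun i => Measure.dirac (ζ i ω)) (φ ⁻¹' {(c : ℝ≥0∞)}) ≠ ∞ := by
      rw [ae_all_iff]
      intro c
      by_cases hc : (c : ℝ≥0∞) = 0
      · simp [hc]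
      · filter_upwards [h.ae_count_ne_top (φ.measurableSet_fiber c) (hms c hc).ne] with ω hω _
        exact hω
    filter_upwards [this] with ω hω
    rw [infProd_simpleFunc φ _ fun c hc hc0 => hω ⟨c, hc⟩ hc0]
    exact (Finset.prod_coe_sort φ.range fun c => (1 - c) ^
      (Measure.sum (fun i => Measure.dirac (ζ i ω)) (φ ⁻¹' {c})).toReal).symm
  have hle : ∀ c ∈ φ.range, c ≤ 1 := fun c hc => by
    obtain ⟨x, rfl⟩ := SimpleFunc.mem_range.1 hc
    exact hφ x
  -- Independence of counts is given for families indexed by `Fin n`, so the values of `φ` are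
  -- enumerated.
  let e := φ.range.equivFin
  have hind := (h.poisson.indep_count _ (fun i => φ ⁻¹' {((e.symm i : φ.range) : ℝ≥0∞)})
    (fun i => φ.measurableSet_fiber _) (fun i j hij => by
      refine Disjoint.preimage φ ?_
      rw [disjoint_singleton]
      exact fun hh => hij (e.symm.injective (Subtype.ext hh)))).comp
    (fun i (x : ℝ≥0∞) => (1 - ((e.symm i : φ.range) : ℝ≥0∞)) ^ x.toReal)
    (fun i => by fun_prop)
  have hkey := lintegral_prod_eq_prod_lintegral_of_indepFun Finset.univ _ hind
    (fun i => Measurable.comp (by fun_prop)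
      (h.poisson.measurable_count _ (φ.measurableSet_fiber _)))
  rw [lintegral_congr_ae hae]
  have hre : ∀ ω, ∏ c : φ.range, (1 - (c : ℝ≥0∞)) ^
        (Measure.sum (fun i => Measure.dirac (ζ i ω)) (φ ⁻¹' {(c : ℝ≥0∞)})).toReal =
      ∏ i, ((fun (x : ℝ≥0∞) => (1 - ((e.symm i : φ.range) : ℝ≥0∞)) ^ x.toReal) ∘
        fun ω => Measure.sum (fun i => Measure.dirac (ζ i ω))
          (φ ⁻¹' {((e.symm i : φ.range) : ℝ≥0∞)})) ω := fun ω =>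
    (Equiv.prod_comp e.symm fun c : φ.range => (1 - (c : ℝ≥0∞)) ^
        (Measure.sum (fun i => Measure.dirac (ζ i ω)) (φ ⁻¹' {(c : ℝ≥0∞)})).toReal).symm
  simp only [hre]
  rw [hkey]
  have hone : ∀ c : φ.range, ∫⁻ ω, (1 - (c : ℝ≥0∞)) ^
        (Measure.sum (fun i => Measure.dirac (ζ i ω)) (φ ⁻¹' {(c : ℝ≥0∞)})).toReal ∂P =
      ENNReal.ofReal (Real.exp (-((c : ℝ≥0∞) * frechetIntensity (φ ⁻¹' {(c : ℝ≥0∞)})).toReal)) := by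
    intro c
    by_cases hc : (c : ℝ≥0∞) = 0
    · simp [hc]
    · have hft := (hms c hc).ne
      have := lintegral_rpow_poisson (frechetIntensity (φ ⁻¹' {(c : ℝ≥0∞)})).toNNReal
        (hle c c.2)
      rw [← h.poisson.law_count _ (φ.measurableSet_fiber _) hft,
        lintegral_map (by fun_prop) (h.poisson.measurable_count _ (φ.measurableSet_fiber _)),
        ENNReal.coe_toNNReal hft] at this
      exact this
  have hcomp := Equiv.prod_comp e.symm fun c : φ.range => ∫⁻ ω, (1 - (c : ℝ≥0∞)) ^
        (Measure.sum (fun i => Measure.dirac (ζ i ω)) (φ ⁻¹' {(c : ℝ≥0∞)})).toReal ∂P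
  refine hcomp.trans ?_
  simp only [hone]
  rw [← ENNReal.ofReal_prod_of_nonneg fun _ _ => (Real.exp_pos _).le, ← Real.exp_sum,
    Finset.sum_neg_distrib, SimpleFunc.lintegral, ← Finset.sum_coe_sort φ.range,
    ENNReal.toReal_sum]
  intro c _
  by_cases hc : (c : ℝ≥0∞) = 0
  · simp [hc]
  · exact ENNReal.mul_ne_top (ne_top_of_le_ne_top ENNReal.one_ne_top (hle c c.2)) (hms c hc).ne

lemma IsFrechetPoints.lintegral_infProd_one_sub (h : IsFrechetPoints P ζ) {f : ℝ → ℝ≥0∞}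
    (hf : Measurable f) (hf1 : ∀ x, f x ≤ 1) (hfin : ∫⁻ x, f x ∂frechetIntensity ≠ ∞) :
    ∫⁻ ω, infProd (fun i => 1 - f (ζ i ω)) ∂P =
      ENNReal.ofReal (Real.exp (-(∫⁻ x, f x ∂frechetIntensity).toReal)) := by
  set φ := SimpleFunc.eapprox f
  have hφle : ∀ n x, φ n x ≤ f x := fun n x => by
    rw [← SimpleFunc.iSup_eapprox_apply hf x]
    exact le_iSup (fun n => φ n x) n
  have hmono : Monotone fun n x => φ n x := fun m n hmn x => SimpleFunc.monotone_eapprox f hmn x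
  have hint : Filter.Tendsto (fun n => ∫⁻ x, φ n x ∂frechetIntensity) Filter.atTop
      (nhds (∫⁻ x, f x ∂frechetIntensity)) := by
    refine lintegral_tendsto_of_tendsto_of_monotone (fun n => (φ n).measurable.aemeasurable)
      (ae_of_all _ fun x m n hmn => hmono hmn x) (ae_of_all _ fun x => ?_)
    rw [← SimpleFunc.iSup_eapprox_apply hf x]
    exact tendsto_atTop_iSup fun m n hmn => hmono hmn x
  have hfin' : ∀ n, ∫⁻ x, φ n x ∂frechetIntensity ≠ ∞ := fun n =>
    ne_top_of_le_ne_top hfin (lintegral_mono (hφle n))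
  have heq : ∀ n, ∫⁻ ω, infProd (fun i => 1 - φ n (ζ i ω)) ∂P =
      ENNReal.ofReal (Real.exp (-(∫⁻ x, φ n x ∂frechetIntensity).toReal)) := fun n => by
    have := h.lintegral_infProd_simpleFunc (φ n) (fun x => (hφle n x).trans (hf1 x))
      (by rw [← SimpleFunc.lintegral_eq_lintegral]; exact hfin' n)
    rwa [← SimpleFunc.lintegral_eq_lintegral] at this
  have hlim1 : Filter.Tendsto (fun n => ∫⁻ ω, infProd (fun i => 1 - φ n (ζ i ω)) ∂P) Filter.atTop
      (nhds (ENNReal.ofReal (Real.exp (-(∫⁻ x, f x ∂frechetIntensity).toReal)))) := by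
    simp only [heq]
    refine ENNReal.tendsto_ofReal ((Real.continuous_exp.tendsto _).comp ?_)
    exact ((ENNReal.tendsto_toReal hfin).comp hint).neg
  have hanti : ∀ ω, Antitone fun n => infProd (fun i => 1 - φ n (ζ i ω)) := fun ω m n hmn =>
    iInf_mono fun k => Finset.prod_le_prod' fun i _ => tsub_le_tsub_left (hmono hmn _) 1
  have hpt : ∀ ω, infProd (fun i => 1 - f (ζ i ω)) =
      ⨅ n, infProd (fun i => 1 - φ n (ζ i ω)) := fun ω => by
    unfold infProd
    -- Exchanging the two infima leaves only the continuity of finite products to check.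
    rw [iInf_comm]
    congr 1
    ext k
    refine tendsto_nhds_unique (f := fun n => ∏ i ∈ Finset.range k, (1 - φ n (ζ i ω)))
      (l := Filter.atTop) ?_ (tendsto_atTop_iInf fun m n hmn =>
        Finset.prod_le_prod' fun i _ => tsub_le_tsub_left (hmono hmn _) 1)
    refine ENNReal.tendsto_finsetProd_of_ne_top _ (fun i _ => ?_) (fun i _ => ?_)
    · refine ENNReal.Tendsto.sub tendsto_const_nhds ?_ (Or.inl ENNReal.one_ne_top)
      rw [← SimpleFunc.iSup_eapprox_apply hf]
      exact tendsto_atTop_iSup fun m n hmn => hmono hmn _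
    · exact ne_top_of_le_ne_top ENNReal.one_ne_top tsub_le_self
  simp only [hpt]
  have hmeas : ∀ n, Measurable fun ω => infProd fun i => 1 - φ n (ζ i ω) := fun n =>
    measurable_infProd fun i => measurable_const.sub ((φ n).measurable.comp (h.measurable i))
  rw [lintegral_iInf hmeas (fun m n hmn ω => hanti ω hmn)]
  · refine tendsto_nhds_unique (tendsto_atTop_iInf fun m n hmn => ?_) hlim1
    exact lintegral_mono fun ω => hanti ω hmn
  · refine ne_top_of_le_ne_top ENNReal.one_ne_top ?_
    calc _ ≤ ∫⁻ _, 1 ∂P := lintegral_mono fun ω => infProd_le_one _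
      _ = 1 := by simp

end

section

variable {Ω : Type*} [MeasurableSpace Ω] {P : Measure Ω} {ζ : ℕ → Ω → ℝ}

/-! ### Independent marking -/

/-- The marked points `(ζ i, W i)` have the generating functional of a Poisson process with
intensity `ζ⁻² dζ ⊗ ν`. -/
def HasPoissonFunctional {E : Type*} [MeasurableSpace E] (P : Measure Ω) (ζ : ℕ → Ω → ℝ)
    (W : ℕ → Ω → E) (ν : Measure E) : Prop :=
  ∀ f : ℝ × E → ℝ≥0∞, Measurable f → (∀ p, f p ≤ 1) →
    ∫⁻ p, f p ∂(frechetIntensity.prod ν) ≠ ∞ →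
    ∫⁻ ω, infProd (fun i => 1 - f (ζ i ω, W i ω)) ∂P =
      ENNReal.ofReal (Real.exp (-(∫⁻ p, f p ∂(frechetIntensity.prod ν)).toReal))

/-- Given the sequence `U`, the marks are still i.i.d. with law `ν`, so each factor is averaged
separately. `U` is kept general to serve both for `ζ` and for the pairs `(ζ, Y)`. -/
lemma lintegral_prod_marks [IsProbabilityMeasure P] {E F : Type*} [MeasurableSpace E]
    [MeasurableSpace F] {U : ℕ → Ω → F} {W : ℕ → Ω → E} {ν : Measure E}
    (hU : ∀ i, Measurable (U i)) (hW : ∀ i, Measurable (W i)) (hWind : iIndepFun W P)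
    (hlaw : ∀ i, P.map (W i) = ν)
    (hUW : IndepFun (fun ω i => U i ω) (fun ω i => W i ω) P)
    {H : F × E → ℝ≥0∞} (hH : Measurable H) (n : ℕ) :
    ∫⁻ ω, ∏ i ∈ Finset.range n, H (U i ω, W i ω) ∂P =
      ∫⁻ ω, ∏ i ∈ Finset.range n, ∫⁻ w, H (U i ω, w) ∂ν ∂P := by
  have mU : Measurable fun ω i => U i ω := measurable_pi_lambda _ hU
  have mW : Measurable fun ω i => W i ω := measurable_pi_lambda _ hW
  have hprod := (indepFun_iff_map_prod_eq_prod_map_map mU.aemeasurable mW.aemeasurable).1 hUW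
  have mF : Measurable fun p : (ℕ → F) × (ℕ → E) => ∏ i ∈ Finset.range n, H (p.1 i, p.2 i) :=
    Finset.measurable_prod _ fun i _ => by fun_prop
  have hν : IsProbabilityMeasure ν := hlaw 0 ▸ Measure.isProbabilityMeasure_map (hW 0).aemeasurable
  calc ∫⁻ ω, ∏ i ∈ Finset.range n, H (U i ω, W i ω) ∂P
      = ∫⁻ p, ∏ i ∈ Finset.range n, H (p.1 i, p.2 i)
          ∂(P.map fun ω => ((fun i => U i ω), fun i => W i ω)) :=
        (lintegral_map mF (mU.prodMk mW)).symm
    _ = ∫⁻ u, ∫⁻ w, ∏ i ∈ Finset.range n, H (u i, w i) ∂(P.map fun ω i => W i ω)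
          ∂(P.map fun ω i => U i ω) := by
        rw [hprod, lintegral_prod _ mF.aemeasurable]
    _ = ∫⁻ u, ∏ i ∈ Finset.range n, ∫⁻ w, H (u i, w) ∂ν ∂(P.map fun ω i => U i ω) := by
        congr 1
        ext u
        rw [lintegral_map (Finset.measurable_prod _ fun i _ => by fun_prop) mW]
        have := lintegral_prod_eq_prod_lintegral_of_indepFun (Finset.range n) _
          (hWind.comp (fun i w => H (u i, w)) fun i => hH.comp measurable_prodMk_left)
          (fun i => (hH.comp measurable_prodMk_left).comp (hW i))
        refine this.trans (Finset.prod_congr rfl fun i _ => ?_)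
        rw [← hlaw i, lintegral_map (by fun_prop) (hW i)]
        rfl
    _ = _ := by
        rw [lintegral_map _ mU]
        exact Finset.measurable_prod _ fun i _ =>
          hH.lintegral_prod_right'.comp (measurable_pi_apply i)

/-- Averaging `f` over its mark gives a function of `ζ` alone, to which the unmarked functional
applies. Marking enters only through `hmark`, which is verified in one stage for `Y` and in two for
`Y / η'`. -/
lemma IsFrechetPoints.hasPoissonFunctional [IsProbabilityMeasure P] {E : Type*}
    [MeasurableSpace E] (h : IsFrechetPoints P ζ) {W : ℕ → Ω → E} {ν : Measure E}
    [IsProbabilityMeasure ν] (hW : ∀ i, Measurable (W i))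
    (hmark : ∀ H : ℝ × E → ℝ≥0∞, Measurable H → ∀ n,
      ∫⁻ ω, ∏ i ∈ Finset.range n, H (ζ i ω, W i ω) ∂P =
        ∫⁻ ω, ∏ i ∈ Finset.range n, ∫⁻ w, H (ζ i ω, w) ∂ν ∂P) :
    HasPoissonFunctional P ζ W ν := by
  intro f hf hf1 hfin
  have hg : Measurable fun z => ∫⁻ w, f (z, w) ∂ν := hf.lintegral_prod_right'
  have hg1 : ∀ z, ∫⁻ w, f (z, w) ∂ν ≤ 1 := fun z => by
    calc ∫⁻ w, f (z, w) ∂ν ≤ ∫⁻ _, 1 ∂ν := lintegral_mono fun w => hf1 _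
      _ = 1 := by simp
  have hsub : ∀ z, ∫⁻ w, (1 - f (z, w)) ∂ν = 1 - ∫⁻ w, f (z, w) ∂ν := fun z => by
    rw [lintegral_sub (by fun_prop)
      (ne_top_of_le_ne_top ENNReal.one_ne_top (hg1 z)) (ae_of_all _ fun w => hf1 _)]
    simp
  rw [lintegral_prod _ hf.aemeasurable] at hfin ⊢
  have hζ := h.measurable
  have m1 : ∀ i, Measurable fun ω => 1 - f (ζ i ω, W i ω) := fun i => by fun_prop
  have m2 : ∀ i, Measurable fun ω => 1 - ∫⁻ w, f (ζ i ω, w) ∂ν := fun i =>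
    measurable_const.sub (hg.comp (hζ i))
  rw [← h.lintegral_infProd_one_sub hg hg1 hfin, lintegral_infProd m1 (fun i a => tsub_le_self),
    lintegral_infProd m2 (fun i a => tsub_le_self)]
  congr 1
  ext n
  rw [hmark (fun p => 1 - f p) (measurable_const.sub hf) n]
  simp only [hsub]

/-! ### Spectral functions attached to Poisson points -/

variable {T : Type*}

/-- The points `(ζ i, W i)` form a Poisson process with intensity `ζ⁻² dζ ⊗ ν`, where `ν` is the
law of a nonnegative process with unit mean. -/
structure IsMarkedPoisson (P : Measure Ω) (ζ : ℕ → Ω → ℝ) (W : ℕ → Ω → T → ℝ)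
    (ν : Measure (T → ℝ)) : Prop where
  measurable_points : ∀ i, Measurable (ζ i)
  measurable_marks : ∀ i, Measurable (W i)
  nonneg : ∀ t, ∀ᵐ w ∂ν, 0 ≤ w t
  mean_eq_one : ∀ t, ∫⁻ w, ENNReal.ofReal (w t) ∂ν = 1
  functional : HasPoissonFunctional P ζ W ν

lemma measurable_maxProcess {W : ℕ → Ω → T → ℝ} (hζ : ∀ i, Measurable (ζ i))
    (hW : ∀ i, Measurable (W i)) : Measurable (maxProcess ζ W) :=
  measurable_pi_lambda _ fun t => Measurable.iSup fun i =>
    (hζ i).mul ((measurable_pi_apply t).comp (hW i))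

/-! ### Exponent function and finite-dimensional laws of the maximum. -/

section Exponent

variable {ι : Type*} [Finite ι]

/-- The exponent function `V(x) = E max_j W(s_j) / x_j` of a max-stable vector. -/
def exponent (ν : Measure (T → ℝ)) (s : ι → T) (x : ι → ℝ) : ℝ≥0∞ :=
  ∫⁻ w, ENNReal.ofReal (⨆ j, w (s j) / x j) ∂ν

lemma exists_lt_mul_iff {w x : ι → ℝ} (hw : ∀ j, 0 ≤ w j) (hx : ∀ j, 0 < x j) (z : ℝ) :
    (∃ j, x j < z * w j) ↔ 1 < z * ⨆ j, w j / x j := by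
  constructor
  · rintro ⟨j, hj⟩
    have hz : 0 < z := (pos_iff_pos_of_mul_pos ((hx j).trans hj)).2
      (lt_of_le_of_ne (hw j) fun h0 => by
        rw [← h0, mul_zero] at hj
        exact hj.not_ge (hx j).le)
    calc 1 < z * (w j / x j) := by rwa [← mul_div_assoc, one_lt_div (hx j)]
      _ ≤ _ := mul_le_mul_of_nonneg_left
        (le_ciSup (f := fun j => w j / x j) (Set.finite_range _).bddAbove j) hz.le
  · intro h
    rcases isEmpty_or_nonempty ι with hι | hι
    -- Over no sites the real supremum is 0, so both sides are false.
    · rw [Real.iSup_of_isEmpty, mul_zero] at h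
      exact absurd h (not_lt.2 zero_le_one)
    · obtain ⟨j, hj⟩ := exists_eq_ciSup_of_finite (f := fun j => w j / x j)
      rw [← hj, ← mul_div_assoc, one_lt_div (hx j)] at h
      exact ⟨j, h⟩

lemma measurableSet_exists_lt (s : ι → T) (x : ι → ℝ) :
    MeasurableSet {p : ℝ × (T → ℝ) | ∃ j, x j < p.1 * p.2 (s j)} := by
  rw [ofPred_exists]
  exact MeasurableSet.iUnion fun j => measurableSet_lt measurable_const
    (measurable_fst.mul ((measurable_pi_apply (s j)).comp measurable_snd))

variable {W : ℕ → Ω → T → ℝ} {ν : Measure (T → ℝ)} [IsProbabilityMeasure ν]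

lemma IsMarkedPoisson.prod_exists_lt (h : IsMarkedPoisson P ζ W ν) (s : ι → T) {x : ι → ℝ}
    (hx : ∀ j, 0 < x j) :
    frechetIntensity.prod ν {p | ∃ j, x j < p.1 * p.2 (s j)} = exponent ν s x := by
  rw [Measure.prod_apply_symm (measurableSet_exists_lt s x)]
  refine lintegral_congr_ae ?_
  filter_upwards [ae_all_iff.2 fun j => h.nonneg (s j)] with w hw
  rw [← frechetIntensity_one_lt_mul (Real.iSup_nonneg fun j => div_nonneg (hw j) (hx j).le)]
  congr 1
  ext z
  exact exists_lt_mul_iff hw hx z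

omit [Finite ι] [IsProbabilityMeasure ν] in
lemma IsMarkedPoisson.exponent_unique [Unique ι] (h : IsMarkedPoisson P ζ W ν) (s : ι → T)
    {x : ι → ℝ} (hx : ∀ j, 0 < x j) : exponent ν s x = ENNReal.ofReal (x default)⁻¹ := by
  simp only [exponent, ciSup_unique, div_eq_mul_inv]
  simp only [ENNReal.ofReal_mul' (inv_pos.2 (hx default)).le]
  rw [lintegral_mul_const _ (by fun_prop), h.mean_eq_one, one_mul]

omit [IsProbabilityMeasure ν] in
lemma IsMarkedPoisson.exponent_ne_top (h : IsMarkedPoisson P ζ W ν) (s : ι → T) {x : ι → ℝ}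
    (hx : ∀ j, 0 < x j) : exponent ν s x ≠ ∞ := by
  have := Fintype.ofFinite ι
  have hle : exponent ν s x ≤ ∑ j, ENNReal.ofReal (x j)⁻¹ := by
    calc exponent ν s x ≤ ∫⁻ w, ∑ j, ENNReal.ofReal (w (s j) / x j) ∂ν := by
          refine lintegral_mono_ae ?_
          filter_upwards [ae_all_iff.2 fun j => h.nonneg (s j)] with w hw
          rw [← ENNReal.ofReal_sum_of_nonneg fun j _ => div_nonneg (hw j) (hx j).le]
          refine ENNReal.ofReal_le_ofReal (Real.iSup_le (fun j => ?_)
            (Finset.sum_nonneg fun j _ => div_nonneg (hw j) (hx j).le))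
          exact Finset.single_le_sum (f := fun j => w (s j) / x j)
            (fun j _ => div_nonneg (hw j) (hx j).le) (Finset.mem_univ j)
      _ = ∑ j, ENNReal.ofReal (x j)⁻¹ := by
          rw [lintegral_finsetSum _ fun j _ => by fun_prop]
          refine Finset.sum_congr rfl fun j _ => ?_
          have := h.exponent_unique (ι := Unit) (fun _ => s j) (x := fun _ => x j) fun _ => hx j
          simpa [exponent] using this
  exact ne_top_of_le_ne_top (by simp) hle

/-- A void probability: the functional applied to the indicator of the exceedance set. It is phrased
with the individual points because the real supremum in `maxProcess` is 0 on unbounded families;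
boundedness is deduced from it next. -/
lemma IsMarkedPoisson.measure_forall_le [IsProbabilityMeasure P] (h : IsMarkedPoisson P ζ W ν)
    (s : ι → T) {x : ι → ℝ} (hx : ∀ j, 0 < x j) :
    P {ω | ∀ j i, ζ i ω * W i ω (s j) ≤ x j} =
      ENNReal.ofReal (Real.exp (-(exponent ν s x).toReal)) := by
  classical
  have hA := measurableSet_exists_lt s x
  have hint : ∫⁻ p, ({p : ℝ × (T → ℝ) | ∃ j, x j < p.1 * p.2 (s j)}.indicator 1 p : ℝ≥0∞)
      ∂(frechetIntensity.prod ν) = exponent ν s x := by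
    rw [lintegral_indicator_one hA, h.prod_exists_lt s hx]
  have := h.functional _ (measurable_one.indicator hA)
    (fun p => indicator_le_self' (fun _ _ => bot_le) p) (by
      rw [hint]; exact h.exponent_ne_top s hx)
  rw [hint] at this
  rw [← this, ← lintegral_indicator_one]
  · congr 1
    ext ω
    have hi : ∀ i, 1 - ({p : ℝ × (T → ℝ) | ∃ j, x j < p.1 * p.2 (s j)}.indicator 1
        (ζ i ω, W i ω) : ℝ≥0∞) = if ∀ j, ζ i ω * W i ω (s j) ≤ x j then 1 else 0 := fun i => by
      by_cases hp : ∃ j, x j < ζ i ω * W i ω (s j)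
      · have : ¬ ∀ j, ζ i ω * W i ω (s j) ≤ x j := by simpa using hp
        simp [indicator, hp, this]
      · have : ∀ j, ζ i ω * W i ω (s j) ≤ x j := by simpa using hp
        simp [indicator, hp, this]
    simp only [hi]
    rw [infProd_indicator]
    simp only [indicator, mem_ofPred_eq, Pi.one_apply, forall_comm (α := ι)]
  · simp only [ofPred_forall]
    exact MeasurableSet.iInter fun j => MeasurableSet.iInter fun i => measurableSet_le
      ((h.measurable_points i).mul ((measurable_pi_apply (s j)).comp (h.measurable_marks i)))
      measurable_const

/-- The bound `n + 1` holds with probability `exp(-1/(n+1))`, which tends to 1. -/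
lemma IsMarkedPoisson.ae_bddAbove [IsProbabilityMeasure P] (h : IsMarkedPoisson P ζ W ν) (t : T) :
    ∀ᵐ ω ∂P, BddAbove (range fun i => ζ i ω * W i ω t) := by
  have hlim : Filter.Tendsto (fun n : ℕ => ENNReal.ofReal (Real.exp (-((n : ℝ) + 1)⁻¹)))
      Filter.atTop (nhds 1) := by
    rw [← ENNReal.ofReal_one, ← Real.exp_zero, ← neg_zero]
    refine ENNReal.tendsto_ofReal ((Real.continuous_exp.tendsto _).comp (Filter.Tendsto.neg ?_))
    simpa using tendsto_one_div_add_atTop_nhds_zero_nat (𝕜 := ℝ)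
  have hsub : MeasurableSet {ω | BddAbove (range fun i => ζ i ω * W i ω t)} :=
    measurableSet_bddAbove_range fun i =>
      (h.measurable_points i).mul ((measurable_pi_apply t).comp (h.measurable_marks i))
  refine (mem_ae_iff_prob_eq_one hsub).2 ?_
  refine le_antisymm prob_le_one (le_of_tendsto' hlim fun n => ?_)
  have hn : (0 : ℝ) < n + 1 := by positivity
  have := h.measure_forall_le (ι := Unit) (fun _ => t) (x := fun _ => (n : ℝ) + 1) fun _ => hn
  rw [h.exponent_unique _ fun _ => hn, ENNReal.toReal_ofReal (inv_pos.2 hn).le] at this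
  rw [← this]
  refine measure_mono fun ω hω => ⟨n + 1, ?_⟩
  rintro _ ⟨i, rfl⟩
  exact hω () i

lemma IsMarkedPoisson.ae_maxProcess_le_iff [IsProbabilityMeasure P]
    (h : IsMarkedPoisson P ζ W ν) (s : ι → T) :
    ∀ᵐ ω ∂P, ∀ x : ι → ℝ, (∀ j, maxProcess ζ W ω (s j) ≤ x j) ↔
      ∀ j i, ζ i ω * W i ω (s j) ≤ x j := by
  filter_upwards [ae_all_iff.2 fun j => h.ae_bddAbove (s j)] with ω hω x
  exact forall_congr' fun j => ciSup_le_iff (hω j)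

lemma IsMarkedPoisson.measure_maxProcess_le [IsProbabilityMeasure P]
    (h : IsMarkedPoisson P ζ W ν) (s : ι → T) {x : ι → ℝ} (hx : ∀ j, 0 < x j) :
    P {ω | ∀ j, maxProcess ζ W ω (s j) ≤ x j} =
      ENNReal.ofReal (Real.exp (-(exponent ν s x).toReal)) := by
  rw [← h.measure_forall_le s hx]
  refine measure_congr ?_
  filter_upwards [h.ae_maxProcess_le_iff s] with ω hω
  exact propext (hω x)

omit [Finite ι] in
lemma IsMarkedPoisson.measure_maxProcess_le_single [IsProbabilityMeasure P]
    (h : IsMarkedPoisson P ζ W ν) (t : T) {x : ℝ} (hx : 0 < x) :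
    P {ω | maxProcess ζ W ω t ≤ x} = ENNReal.ofReal (Real.exp (-x⁻¹)) := by
  have := h.measure_maxProcess_le (ι := Unit) (fun _ => t) (x := fun _ => x) fun _ => hx
  rw [h.exponent_unique _ fun _ => hx, ENNReal.toReal_ofReal (inv_pos.2 hx).le] at this
  rw [← this]
  congr 1
  ext ω
  simp

omit [Finite ι] in
lemma IsMarkedPoisson.ae_maxProcess_pos [IsProbabilityMeasure P]
    (h : IsMarkedPoisson P ζ W ν) (t : T) : ∀ᵐ ω ∂P, 0 < maxProcess ζ W ω t := by
  simp only [ae_iff, not_lt]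
  refine le_antisymm ?_ bot_le
  have hlim : Filter.Tendsto (fun n : ℕ => ENNReal.ofReal (Real.exp (-((n : ℝ) + 1))))
      Filter.atTop (nhds 0) := by
    rw [← ENNReal.ofReal_zero]
    refine ENNReal.tendsto_ofReal (Real.tendsto_exp_neg_atTop_nhds_zero.comp ?_)
    exact Filter.tendsto_atTop_add_const_right _ _ tendsto_natCast_atTop_atTop
  refine ge_of_tendsto' hlim fun n => ?_
  have hn : (0 : ℝ) < n + 1 := by positivity
  have := h.measure_maxProcess_le_single t (inv_pos.2 hn)
  rw [inv_inv] at this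
  rw [← this]
  exact measure_mono fun ω hω => le_trans hω (inv_pos.2 hn).le

end Exponent

end

section

/-! ### A Mecke formula for the maximum -/

/-- For a `0`-`1` sequence `d`, with `d l` marking the points of a set,
this is the expansion of `(1 - ∏ (1 - t d i)) / t`. -/
def thinnedCount (t : ℝ≥0∞) (d : ℕ → ℝ≥0∞) : ℝ≥0∞ :=
  ∑' l, d l * ∏ i ∈ Finset.range l, (1 - t * d i)

/-- Select each `i` independently with probability `t * d i`: either some `l` is selected first, or
none is. Algebraically the sum telescopes. -/
lemma mul_thinnedCount_add_infProd {t : ℝ≥0∞} {d : ℕ → ℝ≥0∞} (ht : t ≤ 1) (hd : ∀ i, d i ≤ 1) :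
    t * thinnedCount t d + infProd (fun i => 1 - t * d i) = 1 := by
  have htd : ∀ i, t * d i ≤ 1 := fun i => mul_le_one' ht (hd i)
  have hstep : ∀ n, t * ∑ l ∈ Finset.range n, d l * ∏ i ∈ Finset.range l, (1 - t * d i) +
      ∏ i ∈ Finset.range n, (1 - t * d i) = 1 := by
    intro n
    induction n with
    | zero => simp
    | succ n ih =>
      rw [Finset.sum_range_succ, Finset.prod_range_succ, mul_add, add_assoc, ← mul_assoc t (d n),
        mul_comm (t * d n), ← mul_add, add_tsub_cancel_of_le (htd n), mul_one, ih]
  have h1 : Filter.Tendsto (fun n => t * ∑ l ∈ Finset.range n,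
      d l * ∏ i ∈ Finset.range l, (1 - t * d i)) Filter.atTop (nhds (t * thinnedCount t d)) :=
    ENNReal.Tendsto.const_mul (ENNReal.tendsto_nat_tsum _)
      (Or.inr (ne_top_of_le_ne_top ENNReal.one_ne_top ht))
  have h2 : Filter.Tendsto (fun n => ∏ i ∈ Finset.range n, (1 - t * d i)) Filter.atTop
      (nhds (infProd fun i => 1 - t * d i)) :=
    tendsto_atTop_iInf (antitone_prod_range fun i => tsub_le_self)
  have h3 := h1.add h2
  simp only [hstep] at h3
  exact (tendsto_nhds_unique h3 tendsto_const_nhds)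

lemma thinnedCount_antitone (d : ℕ → ℝ≥0∞) : Antitone fun t => thinnedCount t d :=
  fun s t hst => ENNReal.tsum_le_tsum fun l => by
    gcongr

lemma iSup_thinnedCount {d : ℕ → ℝ≥0∞} (hd : ∀ i, d i ≤ 1) {t : ℕ → ℝ≥0∞} (ht : Antitone t)
    (ht0 : Filter.Tendsto t Filter.atTop (nhds 0)) :
    ⨆ n, thinnedCount (t n) d = ∑' l, d l := by
  have hdt : ∀ i, d i ≠ ∞ := fun i => ne_top_of_le_ne_top ENNReal.one_ne_top (hd i)
  simp only [thinnedCount, ENNReal.tsum_eq_iSup_nat]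
  rw [iSup_comm]
  congr 1
  ext m
  refine tendsto_nhds_unique (tendsto_atTop_iSup fun a b hab => ?_) ?_ (a :=
    ⨆ n, ∑ l ∈ Finset.range m, d l * ∏ i ∈ Finset.range l, (1 - t n * d i)) (l := Filter.atTop)
    (f := fun n => ∑ l ∈ Finset.range m, d l * ∏ i ∈ Finset.range l, (1 - t n * d i))
  · have := ht hab
    gcongr
  · have hlim : ∀ i, Filter.Tendsto (fun n => 1 - t n * d i) Filter.atTop (nhds 1) := fun i => by
      have := ENNReal.Tendsto.sub (tendsto_const_nhds (x := (1 : ℝ≥0∞)))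
        (ENNReal.Tendsto.mul_const ht0 (Or.inr (hdt i))) (Or.inl ENNReal.one_ne_top)
      simpa using this
    refine tendsto_finsetSum _ fun l _ => ?_
    have := ENNReal.Tendsto.const_mul (a := d l)
      (ENNReal.tendsto_finsetProd_of_ne_top (Finset.range l) (fun i _ => hlim i)
        fun i _ => ENNReal.one_ne_top) (Or.inr (hdt l))
    simpa using this

variable {Ω : Type*} [MeasurableSpace Ω] {P : Measure Ω} {ζ : ℕ → Ω → ℝ}
  {T : Type*} {W : ℕ → Ω → T → ℝ} {ν : Measure (T → ℝ)} {ι : Type*} [Finite ι]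

lemma IsMarkedPoisson.measurable_maxProcess_apply (h : IsMarkedPoisson P ζ W ν) (t : T) :
    Measurable fun ω => maxProcess ζ W ω t :=
  (measurable_pi_apply t).comp (measurable_maxProcess h.measurable_points h.measurable_marks)

lemma IsMarkedPoisson.measurableSet_maxProcess_le (h : IsMarkedPoisson P ζ W ν) (s : ι → T)
    (x : ι → ℝ) : MeasurableSet {ω | ∀ j, maxProcess ζ W ω (s j) ≤ x j} := by
  rw [ofPred_forall]
  exact MeasurableSet.iInter fun j => measurableSet_le (h.measurable_maxProcess_apply (s j))
    measurable_const

variable [IsProbabilityMeasure P] [IsProbabilityMeasure ν]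

/-- With `E` the exceedance set, use the functional at `1_E + t 1_{D \ E}`: a point in `E` kills the
product, which encodes the event on the left, and on that event `D` and `D \ E` contain the same
points. -/
lemma IsMarkedPoisson.lintegral_infProd_thinned (h : IsMarkedPoisson P ζ W ν) (s : ι → T)
    {x : ι → ℝ} (hx : ∀ j, 0 < x j) {D : Set (ℝ × (T → ℝ))} (hD : MeasurableSet D)
    (hDfin : frechetIntensity.prod ν (D \ {p | ∃ j, x j < p.1 * p.2 (s j)}) ≠ ∞) {t : ℝ≥0∞}
    (ht : t ≤ 1) :
    ∫⁻ ω in {ω | ∀ j, maxProcess ζ W ω (s j) ≤ x j},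
        infProd (fun i => 1 - t * D.indicator 1 (ζ i ω, W i ω)) ∂P =
      ENNReal.ofReal (Real.exp (-((exponent ν s x).toReal + t.toReal *
        (frechetIntensity.prod ν (D \ {p | ∃ j, x j < p.1 * p.2 (s j)})).toReal))) := by
  classical
  set A := {ω | ∀ j, maxProcess ζ W ω (s j) ≤ x j} with hAdef
  set E := {p : ℝ × (T → ℝ) | ∃ j, x j < p.1 * p.2 (s j)} with hEdef
  have hE : MeasurableSet E := measurableSet_exists_lt s x
  have htt : t ≠ ∞ := ne_top_of_le_ne_top ENNReal.one_ne_top ht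
  set f : ℝ × (T → ℝ) → ℝ≥0∞ := fun p => E.indicator 1 p + t * (D \ E).indicator 1 p with hf
  have mf : Measurable f := (measurable_one.indicator hE).add
    ((measurable_one.indicator (hD.diff hE)).const_mul t)
  have hint : ∫⁻ p, f p ∂(frechetIntensity.prod ν) =
      exponent ν s x + t * frechetIntensity.prod ν (D \ E) := by
    rw [hf, lintegral_add_left (measurable_one.indicator hE),
      lintegral_const_mul _ (measurable_one.indicator (hD.diff hE)), lintegral_indicator_one hE,
      lintegral_indicator_one (hD.diff hE), h.prod_exists_lt s hx]
  have h2 : t * frechetIntensity.prod ν (D \ E) ≠ ∞ := ENNReal.mul_ne_top htt hDfin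
  have key := h.functional f mf (fun p => by
      by_cases hp : p ∈ E
      · simp [hf, hp]
      · by_cases hpD : p ∈ D <;> simp [hf, hp, hpD, ht]) (by
      rw [hint]
      exact ENNReal.add_ne_top.2 ⟨h.exponent_ne_top s hx, h2⟩)
  rw [hint, ENNReal.toReal_add (h.exponent_ne_top s hx) h2, ENNReal.toReal_mul] at key
  rw [← key, ← lintegral_indicator (h.measurableSet_maxProcess_le s x)]
  refine lintegral_congr_ae ?_
  filter_upwards [h.ae_maxProcess_le_iff s] with ω hω
  by_cases hA : ∀ j, maxProcess ζ W ω (s j) ≤ x j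
  · rw [indicator_of_mem (s := A) hA]
    have hnE : ∀ i, (ζ i ω, W i ω) ∉ E := fun i ⟨j, hj⟩ => hj.not_ge ((hω x).1 hA j i)
    congr 1
    ext i
    by_cases hpD : (ζ i ω, W i ω) ∈ D <;> simp [hf, hnE i, hpD]
  · rw [indicator_of_notMem (s := A) hA]
    rw [hω x] at hA
    push Not at hA
    obtain ⟨j, i, hij⟩ := hA
    refine (le_antisymm ((iInf_le _ (i + 1)).trans ?_) bot_le).symm
    rw [Finset.prod_range_succ]
    have : (ζ i ω, W i ω) ∈ E := ⟨j, hij⟩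
    simp [hf, this]

lemma tendsto_exp_slope (V r : ℝ) {t : ℕ → ℝ} (ht : ∀ n, 0 < t n)
    (ht0 : Filter.Tendsto t Filter.atTop (nhds 0)) :
    Filter.Tendsto (fun n => (t n)⁻¹ * (Real.exp (-V) - Real.exp (-(V + t n * r)))) Filter.atTop
      (nhds (Real.exp (-V) * r)) := by
  have hd : HasDerivAt (fun u => -Real.exp (-(V + u * r))) (Real.exp (-V) * r) 0 := by
    have h1 : HasDerivAt (fun u : ℝ => -(V + u * r)) (-(1 * r)) 0 :=
      (((hasDerivAt_id (0 : ℝ)).mul_const r).const_add V).neg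
    have h2 := h1.exp.neg
    refine h2.congr_deriv ?_
    simp
  have h3 := hasDerivAt_iff_tendsto_slope_zero.1 hd
  have h4 := h3.comp (tendsto_nhdsWithin_iff.2 ⟨ht0, Filter.Eventually.of_forall fun n =>
    (ht n).ne'⟩)
  refine h4.congr fun n => ?_
  simp only [Function.comp_apply, zero_add, smul_eq_mul, zero_mul, add_zero]
  ring

/-- The thinned functional is differentiated at `t = 0`: minus its slope is the integral of
`thinnedCount`, which increases to the number of points in `D` as `t` decreases to 0. On the event
that the maximum is at most `x`, only points outside the exceedance set count, and they are
independent of it. -/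
lemma IsMarkedPoisson.lintegral_count (h : IsMarkedPoisson P ζ W ν) (s : ι → T) {x : ι → ℝ}
    (hx : ∀ j, 0 < x j) {D : Set (ℝ × (T → ℝ))} (hD : MeasurableSet D)
    (hDfin : frechetIntensity.prod ν D ≠ ∞) :
    ∫⁻ ω in {ω | ∀ j, maxProcess ζ W ω (s j) ≤ x j}, ∑' l, D.indicator 1 (ζ l ω, W l ω) ∂P =
      P {ω | ∀ j, maxProcess ζ W ω (s j) ≤ x j} *
        frechetIntensity.prod ν (D \ {p | ∃ j, x j < p.1 * p.2 (s j)}) := by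
  set A := {ω | ∀ j, maxProcess ζ W ω (s j) ≤ x j}
  set L := frechetIntensity.prod ν (D \ {p | ∃ j, x j < p.1 * p.2 (s j)})
  set V := (exponent ν s x).toReal
  have hL : L ≠ ∞ := ne_top_of_le_ne_top hDfin (measure_mono sdiff_subset)
  have hPA : P A = ENNReal.ofReal (Real.exp (-V)) := h.measure_maxProcess_le s hx
  set d : ℕ → Ω → ℝ≥0∞ := fun i ω => D.indicator 1 (ζ i ω, W i ω)
  have hd : ∀ i ω, d i ω ≤ 1 := fun i ω => indicator_le_self' (fun _ _ => bot_le) _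
  have md : ∀ i, Measurable (d i) := fun i => (measurable_one.indicator hD).comp
    ((h.measurable_points i).prodMk (h.measurable_marks i))
  set t : ℕ → ℝ := fun n => 1 / ((n : ℝ) + 1)
  have ht : ∀ n, 0 < t n := fun n => Nat.one_div_pos_of_nat
  have ht0 : Filter.Tendsto t Filter.atTop (nhds 0) := tendsto_one_div_add_atTop_nhds_zero_nat
  have hta : Antitone t := fun m n hmn => Nat.one_div_le_one_div hmn
  have ht1 : ∀ n, t n ≤ 1 := fun n => by simpa [t] using hta (Nat.zero_le n)
  have hT0 : Filter.Tendsto (fun n => ENNReal.ofReal (t n)) Filter.atTop (nhds 0) := by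
    simpa using ENNReal.tendsto_ofReal ht0
  have hTa : Antitone fun n => ENNReal.ofReal (t n) := fun m n hmn =>
    ENNReal.ofReal_le_ofReal (hta hmn)
  have hT1 : ∀ n, ENNReal.ofReal (t n) ≤ 1 := fun n => by simpa using ht1 n
  have mS : ∀ n, Measurable fun ω => thinnedCount (ENNReal.ofReal (t n)) fun i => d i ω :=
    fun n => Measurable.tsum fun l => (md l).mul
      (Finset.measurable_prod _ fun i _ => measurable_const.sub ((md i).const_mul _))
  have hS : ∀ n, ∫⁻ ω in A, thinnedCount (ENNReal.ofReal (t n)) (fun i => d i ω) ∂P =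
      ENNReal.ofReal ((t n)⁻¹ * (Real.exp (-V) - Real.exp (-(V + t n * L.toReal)))) := fun n => by
    -- The identity `mul_thinnedCount_add_infProd` integrated over `A`.
    have h1 : ∫⁻ ω in A, (ENNReal.ofReal (t n) *
        thinnedCount (ENNReal.ofReal (t n)) (fun i => d i ω) +
          infProd (fun i => 1 - ENNReal.ofReal (t n) * d i ω)) ∂P = P A := by
      simp only [mul_thinnedCount_add_infProd (hT1 n) fun i => hd i _]
      simp
    rw [lintegral_add_left ((mS n).const_mul _), lintegral_const_mul _ (mS n),
      h.lintegral_infProd_thinned s hx hD hL (hT1 n), hPA,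
      ENNReal.toReal_ofReal (ht n).le] at h1
    have h2 : ENNReal.ofReal (t n) *
        ∫⁻ ω in A, thinnedCount (ENNReal.ofReal (t n)) (fun i => d i ω) ∂P =
        ENNReal.ofReal (Real.exp (-V) - Real.exp (-(V + t n * L.toReal))) := by
      rw [ENNReal.ofReal_sub _ (Real.exp_pos _).le]
      exact ENNReal.eq_sub_of_add_eq ENNReal.ofReal_ne_top h1
    rw [ENNReal.ofReal_mul (inv_pos.2 (ht n)).le, ← h2, ← mul_assoc, ENNReal.ofReal_inv_of_pos (ht n),
      ENNReal.inv_mul_cancel (by simpa using ht n) ENNReal.ofReal_ne_top, one_mul]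
  have hsup : ∀ ω, ∑' l, d l ω = ⨆ n, thinnedCount (ENNReal.ofReal (t n)) (fun i => d i ω) :=
    fun ω => (iSup_thinnedCount (fun i => hd i ω) hTa hT0).symm
  have hmono : Monotone fun n ω => thinnedCount (ENNReal.ofReal (t n)) (fun i => d i ω) :=
    fun m n hmn ω => thinnedCount_antitone _ (hTa hmn)
  change ∫⁻ ω in A, ∑' l, d l ω ∂P = _
  simp only [hsup]
  rw [lintegral_iSup mS hmono]
  refine tendsto_nhds_unique (tendsto_atTop_iSup fun m n hmn => lintegral_mono (hmono hmn)) ?_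
  simp only [hS]
  have := ENNReal.tendsto_ofReal (tendsto_exp_slope V L.toReal ht ht0)
  rw [ENNReal.ofReal_mul (Real.exp_pos _).le, ENNReal.ofReal_toReal hL, ← hPA] at this
  exact this

end

section

variable {Ω : Type*} [MeasurableSpace Ω] {P : Measure Ω} {ζ : ℕ → Ω → ℝ}
  {T : Type*} {W : ℕ → Ω → T → ℝ} {ν : Measure (T → ℝ)}

/-! ### Lower orthants generate -/

section Orthants

variable {ι : Type*}

lemma isCountablySpanning_range_Iic : IsCountablySpanning (range (Iic : ℝ → Set ℝ)) :=
  ⟨fun n : ℕ => Iic (n : ℝ), fun _ => mem_range_self _, iUnion_eq_univ_iff.2 fun x =>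
    (exists_nat_ge x).imp fun _ h => h⟩

lemma generateFrom_range_Iic_real :
    MeasurableSpace.generateFrom (range (Iic : ℝ → Set ℝ)) = Real.measurableSpace :=
  ((Real.borelSpace).measurable_eq.trans (borel_eq_generateFrom_Iic ℝ)).symm

/-- The lower orthants of `ι → ℝ`. -/
def orthants (ι : Type*) : Set (Set (ι → ℝ)) := pi univ '' pi univ fun _ => range Iic

lemma mem_orthants_iff {B : Set (ι → ℝ)} :
    B ∈ orthants ι ↔ ∃ a : ι → ℝ, B = {v | ∀ j, v j ≤ a j} := by
  constructor
  · rintro ⟨C, hC, rfl⟩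
    choose a ha using fun j => hC j (mem_univ j)
    refine ⟨a, ?_⟩
    ext v
    simp [← ha]
  · rintro ⟨a, rfl⟩
    refine ⟨fun j => Iic (a j), fun j _ => mem_range_self _, ?_⟩
    ext v
    simp [Pi.le_def]

lemma isPiSystem_orthants : IsPiSystem (orthants ι) :=
  IsPiSystem.pi fun _ => isPiSystem_Iic

variable [Finite ι]

lemma isCountablySpanning_orthants : IsCountablySpanning (orthants ι) :=
  IsCountablySpanning.pi fun _ => isCountablySpanning_range_Iic

lemma generateFrom_orthants :
    MeasurableSpace.generateFrom (orthants ι) = MeasurableSpace.pi :=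
  generateFrom_eq_pi (fun _ => generateFrom_range_Iic_real) fun _ => isCountablySpanning_range_Iic

end Orthants

lemma generateFrom_measure_ne_top {α : Type*} [m : MeasurableSpace α] (μ : Measure α)
    [SigmaFinite μ] : MeasurableSpace.generateFrom {D | MeasurableSet D ∧ μ D ≠ ∞} = m := by
  refine le_antisymm (MeasurableSpace.generateFrom_le fun D hD => hD.1) fun D hD => ?_
  rw [← inter_univ D, ← iUnion_spanningSets μ, inter_iUnion]
  refine MeasurableSet.iUnion fun n => MeasurableSpace.measurableSet_generateFrom
    ⟨hD.inter (measurableSet_spanningSets μ n), ?_⟩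
  exact ((measure_mono inter_subset_right).trans_lt (measure_spanningSets_lt_top μ n)).ne

lemma isPiSystem_measure_ne_top {α : Type*} [MeasurableSpace α] (μ : Measure α) :
    IsPiSystem {D | MeasurableSet D ∧ μ D ≠ ∞} := fun _ hA _ hB _ =>
  ⟨hA.1.inter hB.1, ne_top_of_le_ne_top hA.2 (measure_mono inter_subset_left)⟩

lemma isCountablySpanning_measure_ne_top {α : Type*} [MeasurableSpace α] (μ : Measure α)
    [SigmaFinite μ] : IsCountablySpanning {D | MeasurableSet D ∧ μ D ≠ ∞} :=
  ⟨spanningSets μ, fun n => ⟨measurableSet_spanningSets μ n, (measure_spanningSets_lt_top μ n).ne⟩,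
    iUnion_spanningSets μ⟩

/-! ### The joint law of a point and the maximum -/


section

variable {ι : Type*}

lemma IsMarkedPoisson.measurable_sites (h : IsMarkedPoisson P ζ W ν) (s : ι → T) :
    Measurable fun ω j => maxProcess ζ W ω (s j) :=
  measurable_pi_lambda _ fun j => h.measurable_maxProcess_apply (s j)

variable [Finite ι] [IsProbabilityMeasure P] [IsProbabilityMeasure ν]

/-- The law of a Poisson point together with the maximum over all points is the law of a point of
the intensity together with its maximum with an independent copy of the process. -/
lemma IsMarkedPoisson.sum_map_eq (h : IsMarkedPoisson P ζ W ν) (s : ι → T) :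
    Measure.sum (fun l => P.map fun ω => ((ζ l ω, W l ω), fun j => maxProcess ζ W ω (s j))) =
      ((frechetIntensity.prod ν).prod (P.map fun ω j => maxProcess ζ W ω (s j))).map
        fun q => (q.1, fun j => max (q.1.1 * q.1.2 (s j)) (q.2 j)) := by
  have mη := h.measurable_sites s
  have : IsProbabilityMeasure (P.map fun ω j => maxProcess ζ W ω (s j)) :=
    Measure.isProbabilityMeasure_map mη.aemeasurable
  have ml : ∀ l, Measurable fun ω => ((ζ l ω, W l ω), fun j => maxProcess ζ W ω (s j)) := fun l =>
    ((h.measurable_points l).prodMk (h.measurable_marks l)).prodMk mη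
  have mq : Measurable fun q : (ℝ × (T → ℝ)) × (ι → ℝ) =>
      (q.1, fun j => max (q.1.1 * q.1.2 (s j)) (q.2 j)) := by fun_prop
  have hbox : ∀ a : ι → ℝ, MeasurableSet {v : ι → ℝ | ∀ j, v j ≤ a j} := fun a => by
    rw [ofPred_forall]
    exact MeasurableSet.iInter fun j => measurableSet_le (measurable_pi_apply j) measurable_const
  -- Products of finite-intensity sets with lower orthants form a generating π-system on which both
  -- measures are finite; there the count formula gives the left side explicitly.
  have hval : ∀ D, MeasurableSet D → frechetIntensity.prod ν D ≠ ∞ → ∀ a : ι → ℝ,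
      Measure.sum (fun l => P.map fun ω => ((ζ l ω, W l ω), fun j => maxProcess ζ W ω (s j)))
        (D ×ˢ {v | ∀ j, v j ≤ a j}) =
      P {ω | ∀ j, maxProcess ζ W ω (s j) ≤ a j} *
        frechetIntensity.prod ν (D \ {p | ∃ j, a j < p.1 * p.2 (s j)}) := by
    intro D hD hDfin a
    have hA := h.measurableSet_maxProcess_le s a
    rw [Measure.sum_apply _ (hD.prod (hbox a))]
    simp only [Measure.map_apply (ml _) (hD.prod (hbox a))]
    by_cases ha : ∀ j, 0 < a j
    · rw [← h.lintegral_count s ha hD hDfin, lintegral_tsum (f := fun l ω =>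
        D.indicator (1 : ℝ × (T → ℝ) → ℝ≥0∞) (ζ l ω, W l ω)) fun l =>
        ((measurable_one.indicator hD).comp
          ((h.measurable_points l).prodMk (h.measurable_marks l))).aemeasurable]
      congr 1
      ext l
      have mD : MeasurableSet {ω | (ζ l ω, W l ω) ∈ D} :=
        ((h.measurable_points l).prodMk (h.measurable_marks l)) hD
      have : (fun ω => D.indicator (1 : ℝ × (T → ℝ) → ℝ≥0∞) (ζ l ω, W l ω)) =
          {ω | (ζ l ω, W l ω) ∈ D}.indicator 1 := rfl
      rw [this, lintegral_indicator_one mD, Measure.restrict_apply mD]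
      rfl
    · push Not at ha
      -- A nonpositive bound has probability zero, since the maximum is almost surely positive.
      obtain ⟨j, hj⟩ := ha
      have hnull : P {ω | ∀ j, maxProcess ζ W ω (s j) ≤ a j} = 0 := by
        refine measure_mono_null (fun ω hω => ?_) (h.ae_maxProcess_pos (s j))
        exact not_lt.2 ((hω j).trans hj)
      rw [hnull, zero_mul, ENNReal.tsum_eq_zero]
      intro l
      exact measure_mono_null (fun ω hω => hω.2) hnull
  obtain ⟨B, hBC, hBU⟩ := (isCountablySpanning_measure_ne_top (frechetIntensity.prod ν)).prod
    (isCountablySpanning_orthants (ι := ι))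
  refine Measure.ext_of_generateFrom_of_iUnion
    (image2 (· ×ˢ ·) {D | MeasurableSet D ∧ frechetIntensity.prod ν D ≠ ∞} (orthants ι)) B
    (generateFrom_eq_prod (generateFrom_measure_ne_top _) generateFrom_orthants
      (isCountablySpanning_measure_ne_top _) isCountablySpanning_orthants).symm
    ((isPiSystem_measure_ne_top _).prod isPiSystem_orthants) hBU hBC (fun n => ?_) ?_
  · obtain ⟨D, hD, A, hA, hBn⟩ := hBC n
    obtain ⟨a, rfl⟩ := mem_orthants_iff.1 hA
    rw [← hBn]
    dsimp only
    rw [hval D hD.1 hD.2 a]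
    exact ENNReal.mul_ne_top (measure_ne_top _ _)
      (ne_top_of_le_ne_top hD.2 (measure_mono sdiff_subset))
  · rintro _ ⟨D, hD, A, hA, rfl⟩
    obtain ⟨a, rfl⟩ := mem_orthants_iff.1 hA
    dsimp only
    rw [hval D hD.1 hD.2 a, Measure.map_apply mq (hD.1.prod (hbox a))]
    have hset : (fun q : (ℝ × (T → ℝ)) × (ι → ℝ) =>
        (q.1, fun j => max (q.1.1 * q.1.2 (s j)) (q.2 j))) ⁻¹' (D ×ˢ {v | ∀ j, v j ≤ a j}) =
        (D \ {p | ∃ j, a j < p.1 * p.2 (s j)}) ×ˢ {v | ∀ j, v j ≤ a j} := by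
      ext ⟨p, v⟩
      simp only [mem_preimage, mem_prod, mem_ofPred_eq, max_le_iff, mem_sdiff, not_exists, not_lt,
        forall_and, and_assoc]
    rw [hset, Measure.prod_prod, Measure.map_apply mη (hbox a), mul_comm]
    rfl

/-- Nonemptiness matters: over no sites the left side is vacuous while the real infimum is 0. -/
lemma forall_le_mul_iff [Nonempty ι] {w v : ι → ℝ} (hw : ∀ j, 0 ≤ w j) (hv : ∀ j, 0 < v j)
    (z : ℝ) : (∀ j, v j ≤ z * w j) ↔ 1 ≤ z * ⨅ j, w j / v j := by
  constructor
  · intro h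
    obtain ⟨j, hj⟩ := exists_eq_ciInf_of_finite (f := fun j => w j / v j)
    rw [← hj, ← mul_div_assoc, one_le_div (hv j)]
    exact h j
  · intro h j
    have hm : 0 ≤ ⨅ j, w j / v j := Real.iInf_nonneg fun j => div_nonneg (hw j) (hv j).le
    have hz : 0 < z := by
      by_contra hz
      exact absurd h (not_le.2 ((mul_nonpos_of_nonpos_of_nonneg (not_lt.1 hz) hm).trans_lt
        zero_lt_one))
    rw [← one_le_div (hv j), mul_div_assoc]
    exact h.trans (mul_le_mul_of_nonneg_left
      (ciInf_le (f := fun j => w j / v j) (Set.finite_range _).bddBelow j) hz.le)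

/-- The expected number of indices attaining the maximum simultaneously at all sites. -/
lemma IsMarkedPoisson.tsum_measure_attained [Nonempty ι] (h : IsMarkedPoisson P ζ W ν)
    (s : ι → T) :
    ∑' l, P {ω | ∀ j, maxProcess ζ W ω (s j) = ζ l ω * W l ω (s j)} =
      ∫⁻ ω, ∫⁻ w, ENNReal.ofReal (⨅ j, w (s j) / maxProcess ζ W ω (s j)) ∂ν ∂P := by
  have mη := h.measurable_sites s
  have : IsProbabilityMeasure (P.map fun ω j => maxProcess ζ W ω (s j)) :=
    Measure.isProbabilityMeasure_map mη.aemeasurable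
  have ml : ∀ l, Measurable fun ω => ((ζ l ω, W l ω), fun j => maxProcess ζ W ω (s j)) := fun l =>
    ((h.measurable_points l).prodMk (h.measurable_marks l)).prodMk mη
  have mq : Measurable fun q : (ℝ × (T → ℝ)) × (ι → ℝ) =>
      (q.1, fun j => max (q.1.1 * q.1.2 (s j)) (q.2 j)) := by fun_prop
  have mS : MeasurableSet {q : (ℝ × (T → ℝ)) × (ι → ℝ) | ∀ j, q.2 j = q.1.1 * q.1.2 (s j)} := by
    rw [ofPred_forall]
    exact MeasurableSet.iInter fun j => measurableSet_eq_fun (by fun_prop) (by fun_prop)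
  have mS' : MeasurableSet {q : (ℝ × (T → ℝ)) × (ι → ℝ) | ∀ j, q.2 j ≤ q.1.1 * q.1.2 (s j)} := by
    rw [ofPred_forall]
    exact MeasurableSet.iInter fun j => measurableSet_le (by fun_prop) (by fun_prop)
  have key := congrArg (fun μ => μ {q : (ℝ × (T → ℝ)) × (ι → ℝ) |
    ∀ j, q.2 j = q.1.1 * q.1.2 (s j)}) (h.sum_map_eq s)
  rw [Measure.sum_apply _ mS, Measure.map_apply mq mS] at key
  simp only [Measure.map_apply (ml _) mS] at key
  refine Eq.trans key ?_
  -- A point equals its maximum with the independent copy exactly when it dominates the copy.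
  have hset : (fun q : (ℝ × (T → ℝ)) × (ι → ℝ) =>
      (q.1, fun j => max (q.1.1 * q.1.2 (s j)) (q.2 j))) ⁻¹'
      {q | ∀ j, q.2 j = q.1.1 * q.1.2 (s j)} = {q | ∀ j, q.2 j ≤ q.1.1 * q.1.2 (s j)} := by
    ext q
    simp
  rw [hset, Measure.prod_apply_symm mS', lintegral_map (measurable_measure_prodMk_right mS') mη]
  refine lintegral_congr_ae ?_
  filter_upwards [ae_all_iff.2 fun j => h.ae_maxProcess_pos (s j)] with ω hω
  rw [Measure.prod_apply_symm (measurable_prodMk_right mS')]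
  refine lintegral_congr_ae ?_
  filter_upwards [ae_all_iff.2 fun j => h.nonneg (s j)] with w hw
  rw [← frechetIntensity_one_le_mul (Real.iInf_nonneg fun j => div_nonneg (hw j) (hω j).le)]
  congr 1
  ext z
  exact forall_le_mul_iff hw hω z

end

/-! ### Uniqueness of the index attaining the maximum -/

lemma IsMarkedPoisson.measurableSet_attained {ι : Type*} [Finite ι]
    (h : IsMarkedPoisson P ζ W ν) (s : ι → T) (l : ℕ) :
    MeasurableSet {ω | ∀ j, maxProcess ζ W ω (s j) = ζ l ω * W l ω (s j)} := by
  rw [ofPred_forall]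
  exact MeasurableSet.iInter fun j => measurableSet_eq_fun (h.measurable_maxProcess_apply (s j))
    ((h.measurable_points l).mul ((measurable_pi_apply (s j)).comp (h.measurable_marks l)))

variable [IsProbabilityMeasure P] [IsProbabilityMeasure ν]


/-- The reciprocal of a unit Fréchet variable is standard exponential; the layer-cake formula
integrates its tail `e^{-u}`. -/
lemma IsMarkedPoisson.lintegral_inv_max_eq_one (h : IsMarkedPoisson P ζ W ν) (t : T) :
    ∫⁻ ω, ENNReal.ofReal (maxProcess ζ W ω t)⁻¹ ∂P = 1 := by
  have hpos := h.ae_maxProcess_pos t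
  rw [lintegral_eq_lintegral_meas_le P (hpos.mono fun ω hω => (inv_pos.2 hω).le)
    (h.measurable_maxProcess_apply t).inv.aemeasurable]
  have : ∀ u ∈ Ioi (0 : ℝ), P {ω | u ≤ (maxProcess ζ W ω t)⁻¹} =
      ENNReal.ofReal (Real.exp (-u)) := fun u hu => by
    have h1 := h.measure_maxProcess_le_single t (inv_pos.2 hu)
    rw [inv_inv] at h1
    rw [← h1]
    refine measure_congr ?_
    filter_upwards [hpos] with ω hω
    exact propext (le_inv_comm₀ hu hω)
  rw [setLIntegral_congr_fun measurableSet_Ioi this,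
    ← ofReal_integral_eq_lintegral_ofReal (integrableOn_exp_neg_Ioi 0)
      (ae_of_all _ fun x => (Real.exp_pos _).le), integral_exp_neg_Ioi]
  simp

lemma IsMarkedPoisson.tsum_measure_attained_single (h : IsMarkedPoisson P ζ W ν) (t : T) :
    ∑' l, P {ω | maxProcess ζ W ω t = ζ l ω * W l ω t} = 1 := by
  have h1 := h.tsum_measure_attained (ι := Unit) fun _ => t
  simp only [forall_const, ciInf_const, div_eq_mul_inv] at h1
  rw [h1, ← h.lintegral_inv_max_eq_one t]
  refine lintegral_congr_ae ?_
  filter_upwards [h.ae_maxProcess_pos t] with ω hω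
  simp only [ENNReal.ofReal_mul' (inv_pos.2 hω).le]
  rw [lintegral_mul_const _ (by fun_prop), h.mean_eq_one, one_mul]

/-- On each event that the maximum is at most `m + 1`, the expected number of such points is finite,
and these events exhaust the space. -/
lemma IsMarkedPoisson.ae_finite_lt (h : IsMarkedPoisson P ζ W ν) (t : T) {ε : ℝ} (hε : 0 < ε) :
    ∀ᵐ ω ∂P, {i | ε < ζ i ω * W i ω t}.Finite := by
  set D := {p : ℝ × (T → ℝ) | ε < p.1 * p.2 t} with hDdef
  have hD : MeasurableSet D := measurableSet_lt measurable_const (by fun_prop)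
  have hDfin : frechetIntensity.prod ν D ≠ ∞ := by
    have := h.prod_exists_lt (ι := Unit) (fun _ => t) (x := fun _ => ε) fun _ => hε
    simp only [exists_const] at this
    rw [hDdef, this]
    exact h.exponent_ne_top _ fun _ => hε
  have mN : Measurable fun ω => ∑' l, D.indicator (1 : ℝ × (T → ℝ) → ℝ≥0∞) (ζ l ω, W l ω) :=
    Measurable.tsum fun l => (measurable_one.indicator hD).comp
      ((h.measurable_points l).prodMk (h.measurable_marks l))
  have hae : ∀ᵐ ω ∂P, ∀ m : ℕ, maxProcess ζ W ω t ≤ m + 1 →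
      ∑' l, D.indicator (1 : ℝ × (T → ℝ) → ℝ≥0∞) (ζ l ω, W l ω) < ∞ := by
    rw [ae_all_iff]
    intro m
    have hm : (0 : ℝ) < m + 1 := by positivity
    have h1 := h.lintegral_count (ι := Unit) (fun _ => t) (x := fun _ => (m : ℝ) + 1)
      (fun _ => hm) hD hDfin
    simp only [forall_const] at h1
    have h2 := ae_lt_top (μ := P.restrict {ω | maxProcess ζ W ω t ≤ m + 1}) mN (by
      rw [h1]
      exact ENNReal.mul_ne_top (measure_ne_top _ _)
        (ne_top_of_le_ne_top hDfin (measure_mono sdiff_subset)))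
    exact (ae_restrict_iff' (measurableSet_le (h.measurable_maxProcess_apply t)
      measurable_const)).1 h2
  filter_upwards [hae] with ω hω
  obtain ⟨m, hm⟩ := exists_nat_ge (maxProcess ζ W ω t)
  have hlt := hω m (hm.trans (by linarith))
  have : ∑' l, D.indicator (1 : ℝ × (T → ℝ) → ℝ≥0∞) (ζ l ω, W l ω) =
      ({i | ε < ζ i ω * W i ω t}.encard : ℝ≥0∞) := by
    rw [← ENNReal.tsum_set_one, tsum_subtype {i | ε < ζ i ω * W i ω t} fun _ => (1 : ℝ≥0∞)]
    rfl
  rw [this] at hlt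
  simpa [Set.encard_eq_top_iff] using hlt.ne

/-- The positive supremum exceeds some `1/(n+1)`; only finitely many values lie above that level,
and the largest of them is the supremum. -/
lemma IsMarkedPoisson.ae_exists_attained (h : IsMarkedPoisson P ζ W ν) (t : T) :
    ∀ᵐ ω ∂P, ∃ l, maxProcess ζ W ω t = ζ l ω * W l ω t := by
  filter_upwards [h.ae_maxProcess_pos t, h.ae_bddAbove t,
    ae_all_iff.2 fun n : ℕ => h.ae_finite_lt t (Nat.one_div_pos_of_nat (α := ℝ) (n := n))]
    with ω hpos hbdd hfin
  obtain ⟨n, hn⟩ := exists_nat_one_div_lt hpos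
  obtain ⟨i, hi⟩ := exists_lt_of_lt_ciSup hn
  obtain ⟨l, hl, hmax⟩ := (hfin n).exists_maximalFor (fun i => ζ i ω * W i ω t) _ ⟨i, hi⟩
  refine ⟨l, le_antisymm (ciSup_le fun k => ?_) (le_ciSup hbdd l)⟩
  by_contra hk
  push Not at hk
  exact hk.not_ge (hmax (lt_trans hl hk) hk.le)

/-- The number of attaining indices is almost surely at least 1 and has mean 1, hence equals 1
almost surely. -/
lemma IsMarkedPoisson.ae_existsUnique_attained (h : IsMarkedPoisson P ζ W ν) (t : T) :
    ∀ᵐ ω ∂P, ∃! l, maxProcess ζ W ω t = ζ l ω * W l ω t := by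
  set S : ℕ → Set Ω := fun l => {ω | maxProcess ζ W ω t = ζ l ω * W l ω t}
  have mS : ∀ l, MeasurableSet (S l) := fun l => by
    simpa only [forall_const] using h.measurableSet_attained (ι := Unit) (fun _ => t) l
  have mN : Measurable fun ω => ∑' l, (S l).indicator (1 : Ω → ℝ≥0∞) ω :=
    Measurable.tsum fun l => measurable_one.indicator (mS l)
  have hint : ∫⁻ ω, ∑' l, (S l).indicator (1 : Ω → ℝ≥0∞) ω ∂P = 1 := by
    rw [lintegral_tsum fun l => (measurable_one.indicator (mS l)).aemeasurable]
    simp only [lintegral_indicator_one (mS _)]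
    exact h.tsum_measure_attained_single t
  have hge : ∀ᵐ ω ∂P, (1 : ℝ≥0∞) ≤ ∑' l, (S l).indicator (1 : Ω → ℝ≥0∞) ω := by
    filter_upwards [h.ae_exists_attained t] with ω ⟨l, hl⟩
    refine le_trans ?_ (ENNReal.le_tsum l)
    rw [indicator_of_mem (s := S l) hl]
    exact le_rfl
  have heq := ae_eq_of_ae_le_of_lintegral_le hge (by simp) mN.aemeasurable (by simp [hint])
  filter_upwards [h.ae_exists_attained t, heq] with ω ⟨l, hl⟩ hω
  refine ⟨l, hl, fun m hm => ?_⟩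
  by_contra hml
  have h2 : ∑ i ∈ {l, m}, (S i).indicator (1 : Ω → ℝ≥0∞) ω ≤
      ∑' l, (S l).indicator (1 : Ω → ℝ≥0∞) ω := ENNReal.sum_le_tsum _
  rw [Finset.sum_pair (Ne.symm hml), indicator_of_mem (s := S l) hl,
    indicator_of_mem (s := S m) hm, ← hω] at h2
  norm_num at h2

/-- Uniqueness at a single site already makes the events for different `l` almost disjoint, so their
probabilities add up. -/
lemma IsMarkedPoisson.measure_exists_attained {ι : Type*} [Finite ι] [Nonempty ι]
    (h : IsMarkedPoisson P ζ W ν) (s : ι → T) :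
    P {ω | ∃ l, ∀ j, maxProcess ζ W ω (s j) = ζ l ω * W l ω (s j)} =
      ∫⁻ ω, ∫⁻ w, ENNReal.ofReal (⨅ j, w (s j) / maxProcess ζ W ω (s j)) ∂ν ∂P := by
  rw [← h.tsum_measure_attained s, ofPred_exists]
  refine measure_iUnion₀ (fun l m hlm => ?_) fun l =>
    (h.measurableSet_attained s l).nullMeasurableSet
  refine measure_mono_null ?_ (h.ae_existsUnique_attained (s (Classical.arbitrary ι)))
  intro ω hω hu
  exact hlm (hu.unique (hω.1 _) (hω.2 _))

end

section

variable {Ω : Type*} [MeasurableSpace Ω] {P : Measure Ω} {ζ : ℕ → Ω → ℝ}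
  {T : Type*}

/-! ### The two marked Poisson processes -/

section Representation

variable {Y η' : ℕ → Ω → T → ℝ}

lemma IsSpectralProcess.lintegral_eq_one [TopologicalSpace T] {Z : Ω → T → ℝ} (h : IsSpectralProcess P Z) (t : T) :
    ∫⁻ ω, ENNReal.ofReal (Z ω t) ∂P = 1 := by
  -- A non-integrable function would have Bochner integral 0 rather than 1.
  have hint : Integrable (fun ω => Z ω t) P := by
    by_contra hn
    have := h.mean_eq_one t
    rw [integral_undef hn] at this
    exact zero_ne_one this
  rw [← ofReal_integral_eq_lintegral_ofReal hint (ae_of_all _ fun ω => h.nonneg ω t),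
    h.mean_eq_one, ENNReal.ofReal_one]

lemma IsSpectralRepresentation.isMarkedPoisson [IsProbabilityMeasure P] [TopologicalSpace T]
    (h : IsSpectralRepresentation P ζ Y) :
    IsMarkedPoisson P ζ Y (P.map (Y 0)) := by
  have mY := fun i => (h.spectral i).measurable
  have := Measure.isProbabilityMeasure_map (μ := P) (mY 0).aemeasurable
  refine ⟨h.points.measurable, mY, fun t => ?_, fun t => ?_,
    h.points.hasPoissonFunctional mY fun H hH n => ?_⟩
  · rw [ae_map_iff (mY 0).aemeasurable (measurableSet_le measurable_const (measurable_pi_apply t))]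
    exact ae_of_all _ fun ω => (h.spectral 0).nonneg ω t
  · rw [lintegral_map (by fun_prop) (mY 0)]
    exact (h.spectral 0).lintegral_eq_one t
  · exact lintegral_prod_marks h.points.measurable mY h.indep
      (fun i => (h.identDistrib i).map_eq) h.indep_points hH n

lemma measurable_ratio (hY : ∀ i, Measurable (Y i))
    (hη' : ∀ i, Measurable (η' i)) (i : ℕ) : Measurable fun ω t => Y i ω t / η' i ω t :=
  measurable_pi_lambda _ fun t =>
    ((measurable_pi_apply t).comp (hY i)).div ((measurable_pi_apply t).comp (hη' i))

lemma AreIndependentCopies.indepFun_zero (hη' : AreIndependentCopies P ζ Y η') :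
    IndepFun (Y 0) (η' 0) P :=
  hη'.indep_data.comp (φ := fun p : (ℕ → ℝ) × (ℕ → T → ℝ) => p.2 0)
    (ψ := fun q : ℕ → T → ℝ => q 0) (by fun_prop) (by fun_prop)

lemma AreIndependentCopies.lintegral_map_ratio [IsProbabilityMeasure P]
    (hη' : AreIndependentCopies P ζ Y η')
    (hY : Measurable (Y 0)) {f : (T → ℝ) → ℝ≥0∞} (hf : Measurable f) :
    ∫⁻ w, f w ∂(P.map fun ω t => Y 0 ω t / η' 0 ω t) =
      ∫⁻ y, ∫⁻ e, f (fun t => y t / e t) ∂(P.map (η' 0)) ∂(P.map (Y 0)) := by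
  have hE := hη'.measurable 0
  have mdiv : Measurable fun p : (T → ℝ) × (T → ℝ) => fun t => p.1 t / p.2 t := by fun_prop
  have hprod := (indepFun_iff_map_prod_eq_prod_map_map hY.aemeasurable hE.aemeasurable).1
    hη'.indepFun_zero
  have hmap : (P.map fun ω t => Y 0 ω t / η' 0 ω t) =
      ((P.map (Y 0)).prod (P.map (η' 0))).map fun p t => p.1 t / p.2 t := by
    rw [← hprod, Measure.map_map mdiv (hY.prodMk hE)]
    rfl
  have := Measure.isProbabilityMeasure_map (μ := P) hE.aemeasurable
  rw [hmap, lintegral_map hf mdiv, lintegral_prod (fun p : (T → ℝ) × (T → ℝ) => f fun t => p.1 t / p.2 t)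
    (hf.comp mdiv).aemeasurable]

lemma IsSpectralRepresentation.isMarkedPoisson_ratio [IsProbabilityMeasure P]
    [TopologicalSpace T] (h : IsSpectralRepresentation P ζ Y)
    (hη' : AreIndependentCopies P ζ Y η') :
    IsMarkedPoisson P ζ (fun i ω t => Y i ω t / η' i ω t)
      (P.map fun ω t => Y 0 ω t / η' 0 ω t) := by
  have mY := fun i => (h.spectral i).measurable
  have mE := hη'.measurable
  have mZ := measurable_ratio mY mE
  have hM := h.isMarkedPoisson
  have := Measure.isProbabilityMeasure_map (μ := P) (mZ 0).aemeasurable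
  have := Measure.isProbabilityMeasure_map (μ := P) (mY 0).aemeasurable
  have := Measure.isProbabilityMeasure_map (μ := P) (mE 0).aemeasurable
  refine ⟨h.points.measurable, mZ, fun t => ?_, fun t => ?_,
    h.points.hasPoissonFunctional mZ fun H hH n => ?_⟩
  · rw [ae_map_iff (mZ 0).aemeasurable (measurableSet_le measurable_const (measurable_pi_apply t))]
    have hpos : ∀ᵐ ω ∂P, 0 < η' 0 ω t :=
      (hη'.identDistrib 0).symm.ae_snd (p := fun w => 0 < w t)
        (measurableSet_lt measurable_const (measurable_pi_apply t)) (hM.ae_maxProcess_pos t)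
    filter_upwards [hpos] with ω hω
    exact div_nonneg ((h.spectral 0).nonneg ω t) hω.le
  · rw [hη'.lintegral_map_ratio (mY 0) (by fun_prop)]
    -- The mean of `Y(t) / η'(t)` factors as `E Y(t)` times `E 1/η(t)`, both equal to 1.
    have hinv : ∫⁻ e, ENNReal.ofReal (e t)⁻¹ ∂(P.map (η' 0)) = 1 := by
      rw [(hη'.identDistrib 0).map_eq, lintegral_map (by fun_prop)
        (measurable_maxProcess h.points.measurable mY)]
      exact hM.lintegral_inv_max_eq_one t
    have : ∀ᵐ y ∂(P.map (Y 0)), ∫⁻ e, ENNReal.ofReal (y t / e t) ∂(P.map (η' 0)) =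
        ENNReal.ofReal (y t) := by
      filter_upwards [hM.nonneg t] with y hy
      simp only [div_eq_mul_inv, ENNReal.ofReal_mul hy]
      rw [lintegral_const_mul _ (by fun_prop), hinv, mul_one]
    rw [lintegral_congr_ae this]
    exact hM.mean_eq_one t
  -- Marking in two stages: average out `η'` given `(ζ, Y)`, then `Y` given `ζ`.
  · have mH1 : Measurable fun q : (ℝ × (T → ℝ)) × (T → ℝ) =>
        H (q.1.1, fun t => q.1.2 t / q.2 t) := hH.comp (by fun_prop)
    have h1 := lintegral_prod_marks (U := fun i ω => (ζ i ω, Y i ω)) (W := η')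
      (fun i => (h.points.measurable i).prodMk (mY i)) mE hη'.indep
      (fun i => ((hη'.identDistrib i).trans (hη'.identDistrib 0).symm).map_eq)
      (hη'.indep_data.comp (φ := fun p : (ℕ → ℝ) × (ℕ → T → ℝ) => fun i => (p.1 i, p.2 i))
        (ψ := id) (by fun_prop) measurable_id) mH1 n
    have h2 := lintegral_prod_marks h.points.measurable mY h.indep
      (fun i => (h.identDistrib i).map_eq) h.indep_points
      (mH1.lintegral_prod_right' (ν := P.map (η' 0))) n
    refine h1.trans (h2.trans ?_)
    refine lintegral_congr fun ω => Finset.prod_congr rfl fun i _ => ?_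
    exact (hη'.lintegral_map_ratio (mY 0) (hH.comp measurable_prodMk_left)).symm

/-- The concurrence probability is the mean of `min_j Y(s_j) / η(s_j)`, with `η` independent
of `Y`. -/
lemma IsSpectralRepresentation.measure_exists_attained [IsProbabilityMeasure P]
    [TopologicalSpace T] (h : IsSpectralRepresentation P ζ Y)
    (hη' : AreIndependentCopies P ζ Y η') {ι : Type*} [Finite ι] [Nonempty ι] (s : ι → T) :
    P {ω | ∃ l, ∀ j, maxProcess ζ Y ω (s j) = ζ l ω * Y l ω (s j)} =
      ∫⁻ w, ENNReal.ofReal (⨅ j, w (s j)) ∂(P.map fun ω t => Y 0 ω t / η' 0 ω t) := by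
  have mY := fun i => (h.spectral i).measurable
  have mE := hη'.measurable
  have hM := h.isMarkedPoisson
  have := Measure.isProbabilityMeasure_map (μ := P) (mY 0).aemeasurable
  have := Measure.isProbabilityMeasure_map (μ := P) (mE 0).aemeasurable
  have mf : Measurable fun w : T → ℝ => ENNReal.ofReal (⨅ j, w (s j)) :=
    (Measurable.iInf fun j => measurable_pi_apply (s j)).ennreal_ofReal
  have mg : Measurable fun p : (T → ℝ) × (T → ℝ) => ENNReal.ofReal (⨅ j, p.1 (s j) / p.2 (s j)) :=
    (Measurable.iInf fun j => by fun_prop).ennreal_ofReal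
  have hswap := lintegral_lintegral_swap (μ := P.map (Y 0)) (ν := P.map (η' 0))
    (f := fun y e => ENNReal.ofReal (⨅ j, y (s j) / e (s j))) mg.aemeasurable
  rw [hM.measure_exists_attained s, hη'.lintegral_map_ratio (mY 0) mf, hswap, (hη'.identDistrib 0).map_eq,
    lintegral_map mg.lintegral_prod_left' (measurable_maxProcess h.points.measurable mY)]

end Representation

/-! ### Max-stability -/

section MaxStable

variable {W : ℕ → Ω → T → ℝ} {ν : Measure (T → ℝ)}

/-- Finite-dimensional marginals determine a law on `T → ℝ` by uniqueness of projective limits, and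
orthants determine each marginal. -/
lemma measure_ext_of_orthants {μ₁ μ₂ : Measure (T → ℝ)} [IsProbabilityMeasure μ₁]
    [IsProbabilityMeasure μ₂] (h : ∀ (I : Finset T) (a : I → ℝ),
      μ₁ {w | ∀ j : I, w j ≤ a j} = μ₂ {w | ∀ j : I, w j ≤ a j}) : μ₁ = μ₂ := by
  have hproj : ∀ I : Finset T, μ₁.map I.restrict = μ₂.map I.restrict := fun I => by
    have mI := Finset.measurable_restrict (X := fun _ : T => ℝ) I
    have := Measure.isProbabilityMeasure_map (μ := μ₁) mI.aemeasurable
    have := Measure.isProbabilityMeasure_map (μ := μ₂) mI.aemeasurable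
    refine ext_of_generate_finite (orthants I) generateFrom_orthants.symm isPiSystem_orthants
      (fun B hB => ?_) (by simp)
    obtain ⟨a, rfl⟩ := mem_orthants_iff.1 hB
    have mB : MeasurableSet {v : I → ℝ | ∀ j, v j ≤ a j} := by
      rw [ofPred_forall]
      exact MeasurableSet.iInter fun j => measurableSet_le (measurable_pi_apply j) measurable_const
    rw [Measure.map_apply mI mB, Measure.map_apply mI mB]
    exact h I a
  have : ∀ I : Finset T, IsFiniteMeasure (μ₂.map I.restrict) := fun I => inferInstance
  exact IsProjectiveLimit.unique (P := fun I => μ₂.map I.restrict) hproj fun _ => rfl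

/-- Homogeneity of degree `-1`, the source of max-stability. -/
lemma exponent_mul {ι : Type*} (s : ι → T) (x : ι → ℝ) {c : ℝ} (hc : 0 < c) :
    (exponent ν s fun j => c * x j).toReal = c⁻¹ * (exponent ν s x).toReal := by
  have hpt : ∀ w : T → ℝ, ENNReal.ofReal (⨆ j, w (s j) / (c * x j)) =
      ENNReal.ofReal c⁻¹ * ENNReal.ofReal (⨆ j, w (s j) / x j) := fun w => by
    rw [← ENNReal.ofReal_mul (inv_pos.2 hc).le, Real.mul_iSup_of_nonneg (inv_pos.2 hc).le]
    congr 2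
    ext j
    rw [div_mul_eq_div_div_swap, div_eq_inv_mul _ c]
  simp only [exponent, hpt]
  rw [lintegral_const_mul' _ _ ENNReal.ofReal_ne_top, ENNReal.toReal_mul,
    ENNReal.toReal_ofReal (inv_pos.2 hc).le]

lemma IsMarkedPoisson.measure_maxProcess_le_pow [IsProbabilityMeasure P] [IsProbabilityMeasure ν]
    (h : IsMarkedPoisson P ζ W ν) {ι : Type*}
    [Finite ι] (s : ι → T) (a : ι → ℝ) {n : ℕ} (hn : n ≠ 0) :
    P {ω | ∀ j, maxProcess ζ W ω (s j) ≤ n * a j} ^ n =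
      P {ω | ∀ j, maxProcess ζ W ω (s j) ≤ a j} := by
  have hn0 : (0 : ℝ) < n := by positivity
  by_cases ha : ∀ j, 0 < a j
  · rw [h.measure_maxProcess_le s ha, h.measure_maxProcess_le s fun j => mul_pos hn0 (ha j),
      exponent_mul s a hn0, ← ENNReal.ofReal_pow (Real.exp_pos _).le, ← Real.exp_nat_mul]
    congr 2
    field_simp
  · push Not at ha
    obtain ⟨j, hj⟩ := ha
    have hnull : ∀ b : ι → ℝ, b j ≤ 0 → P {ω | ∀ j, maxProcess ζ W ω (s j) ≤ b j} = 0 :=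
      fun b hb => measure_mono_null (fun ω hω => not_lt.2 ((hω j).trans hb))
        (h.ae_maxProcess_pos (s j))
    rw [hnull a hj, hnull (fun j => n * a j) (mul_nonpos_of_nonneg_of_nonpos hn0.le hj),
      zero_pow hn]

lemma IsMarkedPoisson.isSimpleMaxStable [IsProbabilityMeasure P] [IsProbabilityMeasure ν]
    (h : IsMarkedPoisson P ζ W ν) :
    IsSimpleMaxStable P (maxProcess ζ W) := by
  have mξ := measurable_maxProcess h.measurable_points h.measurable_marks
  refine ⟨fun t x hx => ?_, fun n hn => ?_⟩
  · rw [measureReal_def, h.measure_maxProcess_le_single t hx,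
      ENNReal.toReal_ofReal (Real.exp_pos _).le]
  · have hn0 : (0 : ℝ) < n := by positivity
    have : Nonempty (Fin n) := ⟨⟨0, hn⟩⟩
    have mmax : Measurable fun (ω : Fin n → Ω) t => (⨆ i, maxProcess ζ W (ω i) t) / (n : ℝ) :=
      measurable_pi_lambda _ fun t => (Measurable.iSup fun i =>
        (h.measurable_maxProcess_apply t).comp (measurable_pi_apply i)).div_const _
    have := Measure.isProbabilityMeasure_map (μ := P) mξ.aemeasurable
    have := Measure.isProbabilityMeasure_map (μ := Measure.pi fun _ : Fin n => P) mmax.aemeasurable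
    refine ⟨mmax.aemeasurable, mξ.aemeasurable, measure_ext_of_orthants fun I a => ?_⟩
    have mB : MeasurableSet {w : T → ℝ | ∀ j : I, w j ≤ a j} := by
      rw [ofPred_forall]
      exact MeasurableSet.iInter fun j => measurableSet_le (measurable_pi_apply _) measurable_const
    rw [Measure.map_apply mmax mB, Measure.map_apply mξ mB]
    have hset : (fun (ω : Fin n → Ω) t => (⨆ i, maxProcess ζ W (ω i) t) / (n : ℝ)) ⁻¹'
        {w : T → ℝ | ∀ j : I, w j ≤ a j} =
        pi univ fun _ : Fin n => {ω | ∀ j : I, maxProcess ζ W ω j ≤ n * a j} := by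
      ext ω
      simp only [mem_preimage, mem_ofPred_eq, mem_univ_pi, div_le_iff₀' hn0,
        ciSup_le_iff (Set.finite_range _).bddAbove]
      exact forall_comm
    rw [hset, Measure.pi_pi, Finset.prod_const, Finset.card_univ, Fintype.card_fin]
    exact h.measure_maxProcess_le_pow (fun j : I => (j : T)) a (Nat.one_le_iff_ne_zero.1 hn)

/-! ### Extremal coefficients as mean maxima. -/

lemma IsMarkedPoisson.measureReal_le_one [IsProbabilityMeasure P] [IsProbabilityMeasure ν]
    (h : IsMarkedPoisson P ζ W ν) {ι : Type*}
    [Finite ι] (s : ι → T) :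
    P.real {ω | ∀ j, maxProcess ζ W ω (s j) ≤ 1} =
      Real.exp (-(exponent ν s fun _ => 1).toReal) := by
  rw [measureReal_def, h.measure_maxProcess_le s (x := fun _ => 1) fun _ => one_pos,
    ENNReal.toReal_ofReal (Real.exp_pos _).le]

lemma IsMarkedPoisson.integrable_mark (h : IsMarkedPoisson P ζ W ν) (t : T) :
    Integrable (fun w : T → ℝ => w t) ν := by
  refine (lintegral_ofReal_ne_top_iff_integrable
    (measurable_pi_apply t).aestronglyMeasurable (h.nonneg t)).1 ?_
  rw [h.mean_eq_one]
  exact ENNReal.one_ne_top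

lemma IsMarkedPoisson.integral_mark (h : IsMarkedPoisson P ζ W ν) (t : T) :
    ∫ w, w t ∂ν = 1 := by
  rw [integral_eq_lintegral_of_nonneg_ae (h.nonneg t) (measurable_pi_apply t).aestronglyMeasurable,
    h.mean_eq_one, ENNReal.toReal_one]

lemma IsMarkedPoisson.ae_iSup_nonneg (h : IsMarkedPoisson P ζ W ν) {ι : Type*} [Finite ι]
    (s : ι → T) : ∀ᵐ w ∂ν, 0 ≤ ⨆ j, w (s j) := by
  filter_upwards [ae_all_iff.2 fun j => h.nonneg (s j)] with w hw
  exact Real.iSup_nonneg hw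

lemma IsMarkedPoisson.integrable_iSup (h : IsMarkedPoisson P ζ W ν) {ι : Type*} [Finite ι]
    (s : ι → T) : Integrable (fun w : T → ℝ => ⨆ j, w (s j)) ν := by
  refine (lintegral_ofReal_ne_top_iff_integrable
    (Measurable.iSup fun j => measurable_pi_apply (s j)).aestronglyMeasurable
    (h.ae_iSup_nonneg s)).1 ?_
  simpa [exponent] using h.exponent_ne_top s (x := fun _ => 1) fun _ => one_pos

lemma IsMarkedPoisson.extremalCoefficient_eq [IsProbabilityMeasure P] [IsProbabilityMeasure ν]
    (h : IsMarkedPoisson P ζ W ν) {ι : Type*}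
    [Finite ι] (s : ι → T) :
    extremalCoefficient P (maxProcess ζ W) s = ∫ w, ⨆ j, w (s j) ∂ν := by
  rw [extremalCoefficient, h.measureReal_le_one s, Real.log_exp, neg_neg,
    integral_eq_lintegral_of_nonneg_ae (h.ae_iSup_nonneg s)
      (Measurable.iSup fun j => measurable_pi_apply (s j)).aestronglyMeasurable]
  simp [exponent]

end MaxStable

/-! ### The maximum-minimums identity -/

lemma ciSup_insert_finset {ι : Type*} [DecidableEq ι] (a : ι → ℝ) (i : ι) {J : Finset ι}
    (hJ : J.Nonempty) : ⨆ j : (insert i J : Finset ι), a j = ⨆ j : J, max (a i) (a j) := by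
  have := hJ.to_subtype
  have hb : BddAbove (range fun j : (insert i J : Finset ι) => a j) := (finite_range _).bddAbove
  have hb' : BddAbove (range fun j : J => max (a i) (a j)) := (finite_range _).bddAbove
  have := (Finset.insert_nonempty i J).to_subtype
  refine le_antisymm (ciSup_le fun ⟨j, hj⟩ => ?_) (ciSup_le fun j => max_le ?_ ?_)
  · rcases Finset.mem_insert.1 hj with rfl | hj
    · exact (le_max_left _ _).trans (le_ciSup hb' ⟨_, hJ.choose_spec⟩)
    · exact (le_max_right _ _).trans (le_ciSup hb' ⟨j, hj⟩)
  · exact le_ciSup hb ⟨i, Finset.mem_insert_self _ _⟩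
  · exact le_ciSup hb ⟨j, Finset.mem_insert_of_mem j.2⟩

lemma ciInf_insert_finset {ι : Type*} [DecidableEq ι] (a : ι → ℝ) (i : ι) {J : Finset ι}
    (hJ : J.Nonempty) :
    ⨅ j : (insert i J : Finset ι), a j = min (a i) (⨅ j : J, a j) := by
  have := hJ.to_subtype
  have hb : BddBelow (range fun j : (insert i J : Finset ι) => a j) := (finite_range _).bddBelow
  have hb' : BddBelow (range fun j : J => a j) := (finite_range _).bddBelow
  have := (Finset.insert_nonempty i J).to_subtype
  refine le_antisymm (le_min ?_ (le_ciInf fun j => ?_)) (le_ciInf fun ⟨j, hj⟩ => ?_)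
  · exact ciInf_le hb ⟨i, Finset.mem_insert_self _ _⟩
  · exact ciInf_le hb ⟨j, Finset.mem_insert_of_mem j.2⟩
  · rcases Finset.mem_insert.1 hj with rfl | hj
    · exact min_le_left _ _
    · exact (min_le_right _ _).trans (ciInf_le hb' ⟨j, hj⟩)

lemma ciInf_max_left {ι : Type*} [Finite ι] [Nonempty ι] (a : ι → ℝ) (c : ℝ) :
    ⨅ j, max c (a j) = max c (⨅ j, a j) := by
  have hb : BddBelow (range a) := (finite_range _).bddBelow
  obtain ⟨j, hj⟩ := exists_eq_ciInf_of_finite (f := a)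
  refine le_antisymm ?_ (le_ciInf fun j => max_le_max le_rfl (ciInf_le hb j))
  rw [← hj]
  exact ciInf_le (f := fun j => max c (a j)) (finite_range _).bddBelow j

/-- The maximum-minimums identity (the supremum over the empty set is `0`). -/
lemma sum_powerset_iSup {ι : Type*} [DecidableEq ι] {S : Finset ι} (hS : S.Nonempty)
    (a : ι → ℝ) :
    ∑ J ∈ S.powerset, (-1 : ℝ) ^ (J.card + 1) * ⨆ j : J, a j = ⨅ j : S, a j := by
  -- The induction hypothesis is needed for `a` and for `max (a i) (a ·)`; the step is `min(x, m) =
  -- x + m - max(x, m)` together with `max(x, min_j a_j) = min_j max(x, a_j)`.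
  induction hS using Finset.Nonempty.cons_induction generalizing a with
  | singleton i =>
    have h1 : ⨆ j : ({i} : Finset ι), a j = a i := ciSup_unique
    have h2 : ⨅ j : ({i} : Finset ι), a j = a i := ciInf_unique
    have h3 : ({i} : Finset ι).powerset = {∅, {i}} := rfl
    rw [h3, Finset.sum_pair (Finset.singleton_ne_empty i).symm, h1, h2]
    simp
  | cons i S hi hS ih =>
    have := hS.to_subtype
    rw [Finset.cons_eq_insert, Finset.sum_powerset_insert hi, ih, ciInf_insert_finset a i hS]
    -- The `if` corrects the case `J = ∅`, where the supremum on the right is 0 instead of `a i`.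
    have hterm : ∀ J ∈ S.powerset,
        (-1 : ℝ) ^ ((insert i J).card + 1) * ⨆ j : (insert i J : Finset ι), a j =
          (if J = ∅ then a i else 0) -
            (-1 : ℝ) ^ (J.card + 1) * ⨆ j : J, max (a i) (a j) := by
      intro J hJ
      rw [Finset.card_insert_of_notMem fun h => hi (Finset.mem_powerset.1 hJ h)]
      rcases J.eq_empty_or_nonempty with rfl | hne
      · have h1 : ⨆ j : (insert i ∅ : Finset ι), a j = a i := ciSup_unique (ι := ({i} : Finset ι))
        rw [h1]
        simp
      · rw [ciSup_insert_finset a i hne, if_neg hne.ne_empty]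
        ring
    rw [Finset.sum_congr rfl hterm, Finset.sum_sub_distrib,
      ih fun j => max (a i) (a j), ciInf_max_left,
      Finset.sum_ite_eq' S.powerset ∅, if_pos (Finset.empty_mem_powerset S)]
    linarith [min_add_max (a i) (⨅ j : S, a j)]

lemma sum_Icc_powersetCard_iSup {k : ℕ} (hk : 1 ≤ k) (a : Fin k → ℝ) :
    ∑ r ∈ Finset.Icc 1 k, (-1 : ℝ) ^ (r + 1) *
      ∑ J ∈ Finset.powersetCard r (Finset.univ : Finset (Fin k)), ⨆ j : J, a j = ⨅ j, a j := by
  have : Nonempty (Fin k) := ⟨⟨0, hk⟩⟩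
  have h1 := sum_powerset_iSup (Finset.univ_nonempty (α := Fin k)) a
  have h2 : ⨅ j : (Finset.univ : Finset (Fin k)), a j = ⨅ j, a j :=
    (Equiv.subtypeUnivEquiv fun j => Finset.mem_univ j).iInf_congr fun _ => rfl
  rw [h2, Finset.sum_powerset, Finset.card_univ, Fintype.card_fin, Finset.range_eq_Ico,
    Finset.sum_eq_sum_Ico_succ_bot (Nat.succ_pos k)] at h1
  rw [← h1]
  -- The term `r = 0` is the empty supremum, which is 0.
  simp only [Finset.powersetCard_zero, Finset.sum_singleton, Real.iSup_of_isEmpty, mul_zero,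
    zero_add]
  refine Finset.sum_congr rfl fun r _ => ?_
  rw [Finset.mul_sum]
  refine Finset.sum_congr rfl fun J hJ => ?_
  rw [(Finset.mem_powersetCard.1 hJ).2]

lemma ciInf_add_ciSup_fin_two (a : Fin 2 → ℝ) : (⨅ j, a j) + ⨆ j, a j = a 0 + a 1 := by
  have h1 : ⨅ j, a j = min (a 0) (a 1) :=
    le_antisymm (le_min (ciInf_le (finite_range _).bddBelow 0)
      (ciInf_le (finite_range _).bddBelow 1)) (le_ciInf (Fin.forall_fin_two.2
        ⟨min_le_left _ _, min_le_right _ _⟩))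
  have h2 : ⨆ j, a j = max (a 0) (a 1) :=
    le_antisymm (ciSup_le (Fin.forall_fin_two.2 ⟨le_max_left _ _, le_max_right _ _⟩))
      (max_le (le_ciSup (finite_range _).bddAbove 0) (le_ciSup (finite_range _).bddAbove 1))
  rw [h1, h2, min_add_max]

lemma IsSpectralRepresentation.concurrenceProb_eq [IsProbabilityMeasure P]
    [TopologicalSpace T] {Y η' : ℕ → Ω → T → ℝ}
    (h : IsSpectralRepresentation P ζ Y) (hη' : AreIndependentCopies P ζ Y η') {ι : Type*}
    [Finite ι] [Nonempty ι] (s : ι → T) :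
    concurrenceProb P ζ Y s =
      ∫ w, ⨅ j, w (s j) ∂(P.map fun ω t => Y 0 ω t / η' 0 ω t) := by
  have hM := h.isMarkedPoisson_ratio hη'
  rw [concurrenceProb, measureReal_def, h.measure_exists_attained hη' s,
    integral_eq_lintegral_of_nonneg_ae _
      (Measurable.iInf fun j => measurable_pi_apply (s j)).aestronglyMeasurable]
  filter_upwards [ae_all_iff.2 fun j => hM.nonneg (s j)] with w hw
  exact Real.iInf_nonneg hw

end

end ConcurrenceOfExtremes

end

theorem mainTheorem9 {d : ℕ} (X : Set (EuclideanSpace ℝ (Fin d))) (hX : IsCompact X)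
    {Ω : Type*} [MeasurableSpace Ω] (P : Measure Ω) [IsProbabilityMeasure P]
    (ζ : ℕ → Ω → ℝ) (Y : ℕ → Ω → X → ℝ) (hη : IsSpectralRepresentation P ζ Y)
    (η' : ℕ → Ω → X → ℝ) (hη' : AreIndependentCopies P ζ Y η')
    (ξ : Ω → X → ℝ) (hξ : ξ = maxProcess ζ (fun i ω t => Y i ω t / η' i ω t)) :
    IsSimpleMaxStable P ξ ∧
    (∀ (k : ℕ) (s : Fin k → X), 0 < P.real {ω | ∀ j, ξ ω (s j) ≤ 1}) ∧
    (∀ (k : ℕ), 1 ≤ k → ∀ s : Fin k → X,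
      concurrenceProb P ζ Y s =
        ∑ r ∈ Finset.Icc 1 k, (-1 : ℝ) ^ (r + 1) *
          ∑ J ∈ Finset.powersetCard r (Finset.univ : Finset (Fin k)),
            extremalCoefficient P ξ (fun j : J => s j)) ∧
    (∀ s₁ s₂ : X,
      concurrenceProb P ζ Y ![s₁, s₂] = 2 - extremalCoefficient P ξ ![s₁, s₂]) := by

  subst hξ
  have mZ := measurable_ratio (fun i => (hη.spectral i).measurable) hη'.measurable
  have := Measure.isProbabilityMeasure_map (μ := P) (mZ 0).aemeasurable
  have hM := hη.isMarkedPoisson_ratio hη'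
  refine ⟨hM.isSimpleMaxStable, fun k s => ?_, fun k hk s => ?_, fun s₁ s₂ => ?_⟩
  · rw [hM.measureReal_le_one s]
    exact Real.exp_pos _
  · have : Nonempty (Fin k) := ⟨⟨0, hk⟩⟩
    rw [hη.concurrenceProb_eq hη' s]
    -- The identity is applied backwards inside the integral, for each sample function `w`;
    -- linearity does the rest.
    simp only [← sum_Icc_powersetCard_iSup hk, hM.extremalCoefficient_eq]
    rw [integral_finsetSum _ fun r _ => (integrable_finsetSum _ fun (J : Finset (Fin k)) _ =>
      hM.integrable_iSup fun j : J => s j).const_mul _]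
    refine Finset.sum_congr rfl fun r _ => ?_
    rw [integral_const_mul, integral_finsetSum _ fun (J : Finset (Fin k)) _ =>
      hM.integrable_iSup fun j : J => s j]
  -- For two sites the minimum is the sum minus the maximum, and the 2 comes from the two unit
  -- means.
  · have hsum : ∀ w : X → ℝ, ⨅ j, w (![s₁, s₂] j) = w s₁ + w s₂ - ⨆ j, w (![s₁, s₂] j) :=
      fun w => eq_sub_of_add_eq (ciInf_add_ciSup_fin_two fun j => w (![s₁, s₂] j))
    rw [hη.concurrenceProb_eq hη', hM.extremalCoefficient_eq]
    simp only [hsum]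
    have hadd : Integrable (fun w : X → ℝ => w s₁ + w s₂)
        (P.map fun ω t => Y 0 ω t / η' 0 ω t) :=
      (hM.integrable_mark s₁).add (hM.integrable_mark s₂)
    rw [integral_sub hadd (hM.integrable_iSup _),
      integral_add (hM.integrable_mark s₁) (hM.integrable_mark s₂), hM.integral_mark,
      hM.integral_mark]
    norm_num
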